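/- Let $d \ge 1$, $\mathfrak h = L^2(\mathbb R^d)$, let $P_n$ be the antisymmetric orthogonal projection in $\mathfrak h^{\otimes n}$, $f_1\wedge\dots\wedge f_n = P_n(f_1\otimes\dots\otimes f_n)$, and let $\mathcal F=\bigoplus_{n\ge 0}\mathcal F_n$, $\mathcal F_0=\mathbb C$, $\mathcal F_n=P_n\mathfrak h^{\otimes n}$, be the fermionic Fock space, with annihilation operators $a(f)$, $(a(f)\psi)_n(x_1,\dots,x_n)=\sqrt{n+1}\int \overline{f(x)}\,\psi_{n+1}(x,x_1,\dots,x_n)\,dx$, creation operators $a^*(f)=a(f)^*$ and local number operators $n(f)=a^*(f)a(f)$, $f\in\mathfrak h$. Let $\mathfrak A\subseteq\mathcal L(\mathcal F)$ be the $C^*$-algebra generated by all $a(f)$, let $\mathfrak A_0$ be the $C^*$-subalgebra of those $A\in\mathfrak A$ that map every $\mathcal F_n$ into itself, and let $\widehat{\mathfrak A}_0\subseteq\mathcal L(\mathcal F)$ be the closure of $\mathfrak A_0$ with respect to the seminorms $\|A\|_n=\|A\Pi_n\|$, $n\ge 0$, where $\Pi_n$ is the orthogonal projection onto $\mathcal F_n$.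 For bounded operators $A_1,\dots,A_n$ on $\mathfrak h$ let $A_1\wedge\dots\wedge A_n=\frac1{n!}\sum_{\sigma\in S_n}A_{\sigma(1)}\otimes\dots\otimes A_{\sigma(n)}$ on $\mathcal F_n$, and for a bounded operator $C$ on $\mathcal F_m$, $m\le n$, let $C\wedge 1_{n-m}$ be the restriction to $\mathcal F_n$ of $P_n(C\otimes 1^{\otimes(n-m)})P_n$ ($C$ being extended by $0$ from $\mathcal F_m$ to $\mathfrak h^{\otimes m}$). Let $\mathfrak K_n\subseteq\mathcal L(\mathcal F_n)$ be the $C^*$-algebra generated by the operators $C_1\wedge\dots\wedge C_k\wedge 1\wedge\dots\wedge 1$ with $0\le k\le n$ and $C_1,\dots,C_k$ compact on $\mathfrak h$. For $n\ge1$ let $\kappa_n$ map $\sum_{m=0}^n C^{(m)}\wedge 1_{n-m}$, with $C^{(m)}$ a compact operator on $\mathcal F_m$, to $\sum_{m=0}^{n-1}\frac{n-m}{n}\,C^{(m)}\wedge 1_{n-1-m}$. Then $\mathfrak A_0\subsetneq\widehat{\mathfrak A}_0$. Moreover, let $(f_k)_{k\ge1}$ be any orthonormal basis of $\mathfrak h$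 and put $$A_n=\sum_{k=1}^n(-1)^k\,n(f_1)\cdots n(f_k)\big|_{\mathcal F_n},\qquad n\ge 0.$$ Then: 1. $(A_n)_{n\ge0}$ is a bounded coherent sequence: $A_n\in\mathfrak K_n$ for all $n\ge0$, and $\kappa_n(A_n)=A_{n-1}$ for all $n\ge1$ (that is, $A_n$ is of the form $\sum_{m=0}^n C^{(m)}\wedge 1_{n-m}$ with all $C^{(m)}$ compact, and every such representation of $A_n$ gives the value $A_{n-1}$), and $\sup_n\|A_n\|<\infty$. 2. For all $n\ge 0$ and all indices $i_1,\dots,i_n\ge1$, $A_n(f_{i_1}\wedge\dots\wedge f_{i_n})$ is either $0$ or $-f_{i_1}\wedge\dots\wedge f_{i_n}$. 3. $\|A_n\|\le1$ for all $n\ge0$. 4. There is a bounded operator $A$ on $\mathcal F$ with $(A\psi)_n=A_n\psi_n$ for all $\psi\in\mathcal F$ and $n\ge0$; it satisfies $A\in\widehat{\mathfrak A}_0$ and $A\notin\mathfrak A_0$, and it cannot be approximated in norm by elements of $\mathfrak A_0$: there is $\varepsilon>0$ with $\|A-B\|\ge\varepsilon$ for all $B\in\mathfrak A_0$. -/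

import Mathlib

open scoped TensorProduct

noncomputable section

namespace FermiFock

/-- A complex Hilbert space, bundled; only used to define tensor powers by recursion. -/
structure HilbertObj : Type 1 where
  carrier : Type
  [normed : NormedAddCommGroup carrier]
  [inner : InnerProductSpace ℂ carrier]
  [complete : CompleteSpace carrier]

section TensorPowers

variable (H : Type) [NormedAddCommGroup H] [InnerProductSpace ℂ H]

/-- The Hilbert space tensor powers: `H^{⊗ 0} = ℂ` and `H^{⊗ (n+1)} = H ⊗ H^{⊗ n}`,
the completion of the algebraic tensor product. -/
def tensorPowerObj : ℕ → HilbertObj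
  | 0 => { carrier := ℂ }
  | n + 1 =>
    letI := (tensorPowerObj n).normed
    letI := (tensorPowerObj n).inner
    { carrier := UniformSpace.Completion (H ⊗[ℂ] (tensorPowerObj n).carrier) }

/-- The Hilbert space `H^{⊗ n}`. -/
def TPow (n : ℕ) : Type := (tensorPowerObj H n).carrier

instance (n : ℕ) : NormedAddCommGroup (TPow H n) := (tensorPowerObj H n).normed
instance (n : ℕ) : InnerProductSpace ℂ (TPow H n) := (tensorPowerObj H n).inner
instance (n : ℕ) : CompleteSpace (TPow H n) := (tensorPowerObj H n).complete

/-- `H^{⊗ (n+1)}` is the completed tensor product of `H` and `H^{⊗ n}`. -/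
def tpowSucc (n : ℕ) :
    UniformSpace.Completion (H ⊗[ℂ] TPow H n) ≃ₗᵢ[ℂ] TPow H (n + 1) :=
  LinearIsometryEquiv.refl ℂ (TPow H (n + 1))

/-- `H^{⊗ 0} = ℂ`. -/
def tpowZero : ℂ ≃ₗᵢ[ℂ] TPow H 0 := LinearIsometryEquiv.refl ℂ ℂ

variable {H}

/-- The operator `ψ ↦ f ⊗ ψ` from `H^{⊗ n}` to `H^{⊗ (n+1)}`. -/
def tensorLeft (n : ℕ) (f : H) : TPow H n →L[ℂ] TPow H (n + 1) :=
  (tpowSucc H n).toContinuousLinearEquiv.toContinuousLinearMap ∘L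
    UniformSpace.Completion.toComplL ∘L TensorProduct.mkL ℂ H (TPow H n) f

/-- The operator `A ⊗ B` from `H ⊗ H^{⊗ n}` to `H ⊗ H^{⊗ m}`. -/
def opTensor {n m : ℕ} (A : H →L[ℂ] H) (B : TPow H n →L[ℂ] TPow H m) :
    TPow H (n + 1) →L[ℂ] TPow H (m + 1) :=
  (tpowSucc H m).toContinuousLinearEquiv.toContinuousLinearMap ∘L
    (TensorProduct.mapL A B).completion ∘L
      (tpowSucc H n).symm.toContinuousLinearEquiv.toContinuousLinearMap

theorem inner_tensorLeft {n : ℕ} (f g : H) (φ ψ : TPow H n) :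
    inner ℂ (tensorLeft n f φ) (tensorLeft n g ψ) = inner ℂ f g * inner ℂ φ ψ := by
  simp [tensorLeft, LinearIsometryEquiv.inner_map_map]

theorem opTensor_tensorLeft {n m : ℕ} (A : H →L[ℂ] H) (B : TPow H n →L[ℂ] TPow H m)
    (f : H) (ψ : TPow H n) :
    opTensor A B (tensorLeft n f ψ) = tensorLeft m (A f) (B ψ) := by
  simp [tensorLeft, opTensor]

theorem tpow_ext {n : ℕ} {E : Type*} [NormedAddCommGroup E] [NormedSpace ℂ E]
    {S T : TPow H (n + 1) →L[ℂ] E}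
    (h : ∀ f ψ, S (tensorLeft n f ψ) = T (tensorLeft n f ψ)) : S = T := by
  ext x
  obtain ⟨y, rfl⟩ := (tpowSucc H n).surjective x
  induction y using UniformSpace.Completion.induction_on with
  | hp => exact isClosed_eq (by fun_prop) (by fun_prop)
  | ih y =>
    induction y using TensorProduct.induction_on with
    | zero =>
      have h0 : ((0 : H ⊗[ℂ] TPow H n) : UniformSpace.Completion (H ⊗[ℂ] TPow H n)) = 0 :=
        UniformSpace.Completion.coe_zero
      simp only [h0, map_zero]
    | tmul f ψ => exact h f ψ
    | add a b ha hb => simp only [UniformSpace.Completion.coe_add, map_add, ha, hb]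


theorem tensorLeft_add (n : ℕ) (f g : H) :
    tensorLeft n (f + g) = tensorLeft n f + tensorLeft n g := by
  ext ψ; simp [tensorLeft]

/-- The elementary tensor `v₁ ⊗ ⋯ ⊗ vₙ`. -/
def tprod : (n : ℕ) → (Fin n → H) → TPow H n
  | 0, _ => tpowZero H 1
  | n + 1, v => tensorLeft n (v 0) (tprod n (Fin.tail v))

theorem tprod_succ (n : ℕ) (v : Fin (n + 1) → H) :
    tprod (n + 1) v = tensorLeft n (v 0) (tprod n (Fin.tail v)) := rfl

theorem clm_ext_tprod {n : ℕ} {E : Type*} [NormedAddCommGroup E] [NormedSpace ℂ E]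
    {S T : TPow H n →L[ℂ] E} (h : ∀ v, S (tprod n v) = T (tprod n v)) : S = T := by
  induction n with
  | zero =>
    refine ContinuousLinearMap.ext fun x => ?_
    obtain ⟨c, rfl⟩ := (tpowZero H).surjective x
    have h1 : tpowZero H c = c • tpowZero H 1 := by rw [← map_smul]; simp
    rw [h1, map_smul, map_smul]
    exact congrArg _ (h Fin.elim0)
  | succ n ih =>
    refine tpow_ext fun f ψ => ?_
    have := @ih (S ∘L tensorLeft n f) (T ∘L tensorLeft n f) fun v => by
      simpa [tprod_succ, Fin.tail_cons] using h (Fin.cons f v)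
    exact congrArg (fun R => R ψ) this

theorem ext_inner_tprod {n : ℕ} {φ ψ : TPow H n}
    (h : ∀ v, inner ℂ (tprod n v) φ = inner ℂ (tprod n v) ψ) : φ = ψ := by
  have : innerSL ℂ φ = innerSL ℂ ψ := clm_ext_tprod fun v => by
    simp only [innerSL_apply_apply]
    rw [← inner_conj_symm, h v, inner_conj_symm]
  exact ext_inner_right ℂ fun x => congrArg (fun R => R x) this

/-- `Fₙ`: the closed subspace of antisymmetric tensors in `H^{⊗ n}`, i.e. of those `ψ` with
`⟨v_{σ(1)} ⊗ ⋯ ⊗ v_{σ(n)}, ψ⟩ = sgn(σ) ⟨v₁ ⊗ ⋯ ⊗ vₙ, ψ⟩` for all permutations `σ`.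
(For `n = 0` this is all of `ℂ`.) -/
def antisymm (H : Type) [NormedAddCommGroup H] [InnerProductSpace ℂ H] (n : ℕ) :
    Submodule ℂ (TPow H n) where
  carrier := {ψ | ∀ (σ : Equiv.Perm (Fin n)) (v : Fin n → H),
    inner ℂ (tprod n (v ∘ σ)) ψ = ((Equiv.Perm.sign σ : ℤ) : ℂ) * inner ℂ (tprod n v) ψ}
  zero_mem' := by simp
  add_mem' := by
    intro a b ha hb σ v
    rw [inner_add_right, inner_add_right, ha σ v, hb σ v, mul_add]
  smul_mem' := by
    intro c a ha σ v
    rw [inner_smul_right, inner_smul_right, ha σ v, mul_left_comm]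

theorem mem_antisymm {n : ℕ} {ψ : TPow H n} : ψ ∈ antisymm H n ↔
    ∀ (σ : Equiv.Perm (Fin n)) (v : Fin n → H),
      inner ℂ (tprod n (v ∘ σ)) ψ = ((Equiv.Perm.sign σ : ℤ) : ℂ) * inner ℂ (tprod n v) ψ :=
  Iff.rfl

theorem isClosed_antisymm (n : ℕ) : IsClosed (antisymm H n : Set (TPow H n)) := by
  have : (antisymm H n : Set (TPow H n)) = ⋂ (σ : Equiv.Perm (Fin n)) (v : Fin n → H),
      {ψ | inner ℂ (tprod n (v ∘ σ)) ψ =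
        ((Equiv.Perm.sign σ : ℤ) : ℂ) * inner ℂ (tprod n v) ψ} := by
    ext ψ
    simp only [Set.mem_iInter]
    exact Iff.rfl
  rw [this]
  exact isClosed_iInter fun σ => isClosed_iInter fun v => isClosed_eq (by fun_prop) (by fun_prop)

instance (n : ℕ) : CompleteSpace (antisymm H n) :=
  (isClosed_antisymm n).completeSpace_coe

theorem mem_antisymm_of_adjacent {n : ℕ} {ψ : TPow H (n + 1)}
    (h : ∀ (i : Fin n) (v : Fin (n + 1) → H),
      inner ℂ (tprod (n + 1) (v ∘ Equiv.swap i.castSucc i.succ)) ψ =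
        - inner ℂ (tprod (n + 1) v) ψ) : ψ ∈ antisymm H (n + 1) := by
  rw [mem_antisymm]
  intro σ
  have hσ : σ ∈ Submonoid.closure
      (Set.range fun i : Fin n => Equiv.swap i.castSucc i.succ) := by
    rw [Equiv.Perm.mclosure_swap_castSucc_succ]; trivial
  induction hσ using Submonoid.closure_induction with
  | mem x hx =>
    obtain ⟨i, rfl⟩ := hx
    intro v
    rw [h i v, Equiv.Perm.sign_swap (Fin.castSucc_lt_succ).ne]
    simp
  | one => intro v; simp
  | mul x y _ _ hx hy =>
    intro v
    have : v ∘ (x * y : Equiv.Perm (Fin (n + 1))) = (v ∘ x) ∘ y := rfl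
    rw [this, hy, hx]
    simp only [map_mul, Units.val_mul, Int.cast_mul]
    ring

/-- Contraction of the first tensor factor with `f`: the adjoint of `ψ ↦ f ⊗ ψ`. -/
def contract (n : ℕ) (f : H) : TPow H (n + 1) →L[ℂ] TPow H n :=
  ContinuousLinearMap.adjoint (tensorLeft n f)

theorem inner_contract {n : ℕ} (f : H) (φ : TPow H n) (ψ : TPow H (n + 1)) :
    inner ℂ φ (contract n f ψ) = inner ℂ (tensorLeft n f φ) ψ := by
  rw [contract, ContinuousLinearMap.adjoint_inner_right]

theorem contract_tensorLeft {n : ℕ} (g f : H) (ψ : TPow H n) :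
    contract n g (tensorLeft n f ψ) = (inner ℂ g f : ℂ) • ψ := by
  refine ext_inner_left ℂ fun φ => ?_
  rw [inner_contract, inner_tensorLeft, inner_smul_right]

theorem contract_opTensor {n m : ℕ} (g : H) (B : TPow H n →L[ℂ] TPow H m)
    (ψ : TPow H (n + 1)) :
    contract m g (opTensor (ContinuousLinearMap.id ℂ H) B ψ) = B (contract n g ψ) := by
  have : contract m g ∘L opTensor (ContinuousLinearMap.id ℂ H) B = B ∘L contract n g :=
    tpow_ext fun f ψ => by simp [opTensor_tensorLeft, contract_tensorLeft]
  exact congrArg (fun R => R ψ) this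

theorem inner_tprod_succ {n : ℕ} (v : Fin (n + 1) → H) (ψ : TPow H (n + 1)) :
    inner ℂ (tprod (n + 1) v) ψ = inner ℂ (tprod n (Fin.tail v)) (contract n (v 0) ψ) := by
  rw [inner_contract, tprod_succ]

theorem contract_mem {n : ℕ} (g : H) {ψ : TPow H (n + 1)} (hψ : ψ ∈ antisymm H (n + 1)) :
    contract n g ψ ∈ antisymm H n := by
  cases n with
  | zero =>
    intro σ v
    rw [Subsingleton.elim σ 1]
    simp
  | succ n =>
    refine mem_antisymm_of_adjacent fun i v => ?_
    have h := hψ (Equiv.swap i.succ.castSucc i.succ.succ) (Fin.cons g v : Fin (n + 2) → H)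
    rw [Equiv.Perm.sign_swap (Fin.castSucc_lt_succ).ne, inner_tprod_succ,
      inner_tprod_succ (Fin.cons g v)] at h
    have h0 : ((Fin.cons g v : Fin (n + 2) → H) ∘ Equiv.swap i.succ.castSucc i.succ.succ) 0 = g := by
      rw [Function.comp_apply, Equiv.swap_apply_of_ne_of_ne]
      · rfl
      · rw [← Fin.succ_castSucc]; exact (Fin.succ_ne_zero _).symm
      · exact (Fin.succ_ne_zero _).symm
    have h1 : Fin.tail ((Fin.cons g v : Fin (n + 2) → H) ∘ Equiv.swap i.succ.castSucc i.succ.succ)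
        = v ∘ Equiv.swap i.castSucc i.succ := by
      funext j
      have : Equiv.swap i.succ.castSucc i.succ.succ j.succ
          = (Equiv.swap i.castSucc i.succ j).succ := by
        rw [← Fin.succ_castSucc]
        exact ((Fin.succ_injective _).map_swap _ _ _).symm
      simp only [Fin.tail, Function.comp_apply, this, Fin.cons_succ]
    rw [h0, h1, Fin.tail_cons, Fin.cons_zero] at h
    simpa using h

theorem contract_anticomm {n : ℕ} (a b : H) {ψ : TPow H (n + 2)}
    (hψ : ψ ∈ antisymm H (n + 2)) :
    contract n a (contract (n + 1) b ψ) = - contract n b (contract (n + 1) a ψ) := by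
  refine ext_inner_tprod fun v => ?_
  have key : ∀ x y : H, inner ℂ (tprod n v) (contract n x (contract (n + 1) y ψ)) =
      inner ℂ (tprod (n + 2) (Fin.cons y (Fin.cons x v) : Fin (n + 2) → H)) ψ := by
    intro x y
    rw [inner_tprod_succ, inner_tprod_succ]
    rfl
  have h := hψ (Equiv.swap 0 1) (Fin.cons a (Fin.cons b v) : Fin (n + 2) → H)
  have hs : ((Fin.cons a (Fin.cons b v) : Fin (n + 2) → H) ∘ Equiv.swap 0 1)
      = Fin.cons b (Fin.cons a v) := by
    funext j
    refine Fin.cases ?_ (fun j => Fin.cases ?_ (fun j => ?_) j) j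
    · simp only [Function.comp_apply, Equiv.swap_apply_left]; rfl
    · rw [Function.comp_apply, show (Fin.succ 0 : Fin (n + 2)) = 1 from rfl,
        Equiv.swap_apply_right]; rfl
    · rw [Function.comp_apply, Equiv.swap_apply_of_ne_of_ne (Fin.succ_ne_zero _)
        (by rw [show (1 : Fin (n + 2)) = Fin.succ 0 from rfl]
            exact fun h => Fin.succ_ne_zero _ (Fin.succ_injective _ h))]
      rfl
  rw [hs, Equiv.Perm.sign_swap (by simp)] at h
  rw [inner_neg_right, key, key, h]
  simp

theorem mem_antisymm_of_contract {n : ℕ} {ψ : TPow H (n + 2)}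
    (h1 : ∀ g, contract (n + 1) g ψ ∈ antisymm H (n + 1))
    (h2 : ∀ a b, contract n a (contract (n + 1) b ψ) = - contract n b (contract (n + 1) a ψ)) :
    ψ ∈ antisymm H (n + 2) := by
  refine mem_antisymm_of_adjacent fun i v => ?_
  refine Fin.cases ?_ (fun i => ?_) i
  · simp only [inner_tprod_succ]
    have e0 : (v ∘ Equiv.swap (Fin.castSucc 0) (Fin.succ 0)) 0 = v 1 := by
      rw [Function.comp_apply]
      exact congrArg v (Equiv.swap_apply_left _ _)
    have e1 : Fin.tail (v ∘ Equiv.swap (Fin.castSucc (0 : Fin (n + 1))) (Fin.succ 0)) 0 = v 0 := by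
      rw [Fin.tail, Function.comp_apply]
      exact congrArg v (Equiv.swap_apply_right _ _)
    have e2 : Fin.tail (Fin.tail (v ∘ Equiv.swap (Fin.castSucc (0 : Fin (n + 1))) (Fin.succ 0)))
        = Fin.tail (Fin.tail v) := by
      funext j
      simp only [Fin.tail, Function.comp_apply]
      rw [Equiv.swap_apply_of_ne_of_ne]
      · rw [Fin.castSucc_zero]; exact Fin.succ_ne_zero _
      · exact fun h => Fin.succ_ne_zero _ (Fin.succ_injective _ h)
    rw [e0, e1, e2, h2, inner_neg_right]
    rfl
  · rw [inner_tprod_succ, inner_tprod_succ v]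
    have e0 : (v ∘ Equiv.swap (Fin.castSucc i.succ) i.succ.succ) 0 = v 0 := by
      rw [Function.comp_apply, Equiv.swap_apply_of_ne_of_ne]
      · rw [← Fin.succ_castSucc]; exact (Fin.succ_ne_zero _).symm
      · exact (Fin.succ_ne_zero _).symm
    have e1 : Fin.tail (v ∘ Equiv.swap (Fin.castSucc i.succ) i.succ.succ)
        = Fin.tail v ∘ Equiv.swap i.castSucc i.succ := by
      funext j
      have : Equiv.swap i.succ.castSucc i.succ.succ j.succ
          = (Equiv.swap i.castSucc i.succ j).succ := by
        rw [← Fin.succ_castSucc]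
        exact ((Fin.succ_injective _).map_swap _ _ _).symm
      simp only [Fin.tail, Function.comp_apply, this]
    rw [e0, e1, h1 (v 0), Equiv.Perm.sign_swap (Fin.castSucc_lt_succ).ne]
    simp

/-- The alternating sum of all insertions of `f` into a tensor:
`f ⊗ v₁ ⊗ ⋯ ⊗ vₙ - v₁ ⊗ f ⊗ v₂ ⊗ ⋯ ⊗ vₙ + ⋯ ± v₁ ⊗ ⋯ ⊗ vₙ ⊗ f`. -/
def insertAlt (f : H) : (n : ℕ) → TPow H n →L[ℂ] TPow H (n + 1)
  | 0 => tensorLeft 0 f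
  | n + 1 => tensorLeft (n + 1) f - opTensor (ContinuousLinearMap.id ℂ H) (insertAlt f n)

theorem contract_insertAlt {n : ℕ} (g f : H) (ψ : TPow H (n + 1)) :
    contract (n + 1) g (insertAlt f (n + 1) ψ) =
      (inner ℂ g f : ℂ) • ψ - insertAlt f n (contract n g ψ) := by
  simp only [insertAlt, sub_apply, map_sub, contract_tensorLeft,
    contract_opTensor]

theorem antisymm_zero_mem (ψ : TPow H 0) : ψ ∈ antisymm H 0 := by
  intro σ v
  rw [Subsingleton.elim σ 1]
  simp

theorem antisymm_one_mem (ψ : TPow H 1) : ψ ∈ antisymm H 1 := by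
  intro σ v
  rw [Subsingleton.elim σ 1]
  simp

theorem insertAlt_mem (f : H) {n : ℕ} {ψ : TPow H n} (hψ : ψ ∈ antisymm H n) :
    insertAlt f n ψ ∈ antisymm H (n + 1) := by
  induction n with
  | zero => exact antisymm_one_mem _
  | succ n ih =>
    refine mem_antisymm_of_contract (fun g => ?_) (fun a b => ?_)
    · rw [contract_insertAlt]
      exact (antisymm H (n + 1)).sub_mem ((antisymm H (n + 1)).smul_mem _ hψ)
        (ih (contract_mem g hψ))
    · rw [contract_insertAlt, contract_insertAlt]
      cases n with
      | zero =>
        simp only [map_sub, map_smul, insertAlt, contract_tensorLeft, neg_sub]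
      | succ n =>
        simp only [map_sub, map_smul, contract_insertAlt]
        rw [contract_anticomm a b hψ, map_neg]
        abel

theorem inner_insertAlt (f : H) {n : ℕ} (ψ : TPow H n) {φ : TPow H (n + 1)}
    (hφ : φ ∈ antisymm H (n + 1)) :
    inner ℂ (insertAlt f n ψ) φ = ((n : ℂ) + 1) * inner ℂ (tensorLeft n f ψ) φ := by
  induction n with
  | zero => simp [insertAlt]
  | succ n ih =>
    have key : innerSL ℂ φ ∘L opTensor (ContinuousLinearMap.id ℂ H) (insertAlt f n) =
        -((n : ℂ) + 1) • (innerSL ℂ φ ∘L tensorLeft (n + 1) f) := by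
      refine tpow_ext fun g χ => ?_
      simp only [ContinuousLinearMap.comp_apply, opTensor_tensorLeft, innerSL_apply_apply,
        smul_apply, ContinuousLinearMap.id_apply]
      rw [← inner_conj_symm, ← inner_contract, ih χ (contract_mem g hφ), ← inner_contract,
        contract_anticomm f g hφ, inner_neg_right, inner_contract, inner_contract,
        smul_eq_mul, ← inner_conj_symm φ]
      simp
      ring
    have h2 := congrArg (fun R => starRingEnd ℂ (R ψ)) key
    simp only [ContinuousLinearMap.comp_apply, innerSL_apply_apply,
        smul_apply, smul_eq_mul, map_mul, inner_conj_symm] at h2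
    rw [insertAlt, sub_apply, inner_sub_left, h2]
    simp
    ring

theorem contract_contract_self {n : ℕ} (f : H) {ψ : TPow H (n + 2)}
    (hψ : ψ ∈ antisymm H (n + 2)) : contract n f (contract (n + 1) f ψ) = 0 := by
  have h := contract_anticomm f f hψ
  have h2 : (2 : ℂ) • contract n f (contract (n + 1) f ψ) = 0 := by
    rw [two_smul]
    nth_rewrite 1 [h]
    exact neg_add_cancel _
  exact (smul_eq_zero.mp h2).resolve_left two_ne_zero

theorem sqrt_mul_norm_contract_le (f : H) {n : ℕ} {φ : TPow H (n + 1)}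
    (hφ : φ ∈ antisymm H (n + 1)) :
    √((n : ℝ) + 1) * ‖contract n f φ‖ ≤ ‖f‖ * ‖φ‖ := by
  set ψ := contract n f φ with hψ
  have hψm : ψ ∈ antisymm H n := contract_mem f hφ
  set c := insertAlt f n ψ with hc
  have hcm : c ∈ antisymm H (n + 1) := insertAlt_mem f hψm
  have hcc : contract n f c = ((inner ℂ f f : ℂ)) • ψ := by
    cases n with
    | zero => rw [hc, insertAlt, contract_tensorLeft]
    | succ n => rw [hc, contract_insertAlt, hψ, contract_contract_self f hφ, map_zero, sub_zero]
  have h1 : ‖c‖ ^ 2 = ((n : ℝ) + 1) * (‖f‖ ^ 2 * ‖ψ‖ ^ 2) := by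
    have : (inner ℂ c c : ℂ) = ((n : ℂ) + 1) * (inner ℂ f f * inner ℂ ψ ψ) := by
      conv_lhs => rw [hc]
      rw [inner_insertAlt f ψ hcm, ← inner_contract, hcc, inner_smul_right]
    rw [inner_self_eq_norm_sq_to_K, inner_self_eq_norm_sq_to_K, inner_self_eq_norm_sq_to_K] at this
    exact Complex.ofReal_injective (by push_cast; exact this)
  have h2 : ((n : ℝ) + 1) * ‖ψ‖ ^ 2 ≤ ‖c‖ * ‖φ‖ := by
    have : (inner ℂ c φ : ℂ) = ((n : ℂ) + 1) * inner ℂ ψ ψ := by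
      rw [hc, inner_insertAlt f ψ hφ, ← inner_contract]
    have h3 := norm_inner_le_norm (𝕜 := ℂ) c φ
    rw [this, inner_self_eq_norm_sq_to_K] at h3
    have h4 : ‖((n : ℂ) + 1) * ((‖ψ‖ : ℂ)) ^ 2‖ = ((n : ℝ) + 1) * ‖ψ‖ ^ 2 := by
      rw [show ((n : ℂ) + 1) * ((‖ψ‖ : ℂ)) ^ 2 = (((n : ℝ) + 1) * ‖ψ‖ ^ 2 : ℝ) by push_cast; ring,
        Complex.norm_real, Real.norm_of_nonneg (by positivity)]
    exact h4 ▸ h3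
  have h5 : ‖c‖ = √((n : ℝ) + 1) * (‖f‖ * ‖ψ‖) := by
    rw [← Real.sqrt_sq (norm_nonneg c), h1, Real.sqrt_mul (by positivity), ← mul_pow,
      Real.sqrt_sq (by positivity)]
  have hs : 0 < √((n : ℝ) + 1) := Real.sqrt_pos.mpr (by positivity)
  have hs2 : √((n : ℝ) + 1) * √((n : ℝ) + 1) = (n : ℝ) + 1 :=
    Real.mul_self_sqrt (by positivity)
  rcases (norm_nonneg ψ).eq_or_lt with h0 | h0
  · rw [← h0, mul_zero]; positivity
  · rw [h5] at h2
    have h6 : (√((n : ℝ) + 1) * ‖ψ‖) * (√((n : ℝ) + 1) * ‖ψ‖) ≤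
        (√((n : ℝ) + 1) * ‖ψ‖) * (‖f‖ * ‖φ‖) := by
      calc _ = (√((n : ℝ) + 1) * √((n : ℝ) + 1)) * ‖ψ‖ ^ 2 := by ring
        _ = ((n : ℝ) + 1) * ‖ψ‖ ^ 2 := by rw [hs2]
        _ ≤ _ := h2
        _ = _ := by ring
    exact le_of_mul_le_mul_left h6 (by positivity)

end TensorPowers

section Fock

variable (H : Type) [NormedAddCommGroup H] [InnerProductSpace ℂ H]

/-- The `n`-particle space `Fₙ = Pₙ H^{⊗ n}`. -/
def Sector (n : ℕ) : Type := antisymm H n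

instance (n : ℕ) : NormedAddCommGroup (Sector H n) :=
  inferInstanceAs (NormedAddCommGroup (antisymm H n))
instance (n : ℕ) : InnerProductSpace ℂ (Sector H n) :=
  inferInstanceAs (InnerProductSpace ℂ (antisymm H n))
instance (n : ℕ) : CompleteSpace (Sector H n) :=
  inferInstanceAs (CompleteSpace (antisymm H n))

/-- The identification of `Fₙ` with the subspace of antisymmetric tensors. -/
def sectorEquiv (n : ℕ) : antisymm H n ≃ₗᵢ[ℂ] Sector H n :=
  LinearIsometryEquiv.refl ℂ (antisymm H n)

/-- The fermionic Fock space, the Hilbert space direct sum of the `Fₙ`, `n ≥ 0`. -/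
def Fock : Type := lp (fun n => Sector H n) 2

instance : NormedAddCommGroup (Fock H) :=
  inferInstanceAs (NormedAddCommGroup (lp (fun n => Sector H n) 2))
instance : InnerProductSpace ℂ (Fock H) :=
  inferInstanceAs (InnerProductSpace ℂ (lp (fun n => Sector H n) 2))
instance : CompleteSpace (Fock H) :=
  inferInstanceAs (CompleteSpace (lp (fun n => Sector H n) 2))

/-- The identification of Fock space with the space of square summable sequences. -/
def fockEquiv : lp (fun n => Sector H n) 2 ≃ₗᵢ[ℂ] Fock H :=
  LinearIsometryEquiv.refl ℂ (lp (fun n => Sector H n) 2)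

variable {H}

/-- The embedding of `Fₙ` into Fock space. -/
def sectorEmb (n : ℕ) : Sector H n →L[ℂ] Fock H :=
  (fockEquiv H).toContinuousLinearEquiv.toContinuousLinearMap ∘L
    lp.singleContinuousLinearMap ℂ (fun n => Sector H n) 2 n

/-- The `n`-th component `ψₙ` of a Fock space vector `ψ`. -/
def sectorEval (n : ℕ) : Fock H →L[ℂ] Sector H n :=
  lp.evalCLM ℂ (fun n => Sector H n) 2 n ∘L
    (fockEquiv H).symm.toContinuousLinearEquiv.toContinuousLinearMap

theorem fock_ext {φ ψ : Fock H} (h : ∀ n, sectorEval n φ = sectorEval n ψ) : φ = ψ :=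
  lp.ext (funext h)

theorem sectorEval_sectorEmb_self (n : ℕ) (x : Sector H n) :
    sectorEval n (sectorEmb n x) = x :=
  lp.single_apply_self (E := fun n => Sector H n) 2 n x

theorem sectorEval_sectorEmb_ne {m n : ℕ} (h : m ≠ n) (x : Sector H n) :
    sectorEval m (sectorEmb n x) = 0 :=
  lp.single_apply_ne (E := fun n => Sector H n) 2 n x h

theorem inner_sectorEmb_left (n : ℕ) (x : Sector H n) (ψ : Fock H) :
    inner ℂ (sectorEmb n x) ψ = inner ℂ x (sectorEval n ψ) :=
  lp.inner_single_left (G := fun n => Sector H n) n x ψ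

/-- The antisymmetric orthogonal projection `Pₙ`, as a map `H^{⊗ n} → Fₙ`. -/
def antisymmProj (n : ℕ) : TPow H n →L[ℂ] Sector H n :=
  (sectorEquiv H n).toContinuousLinearEquiv.toContinuousLinearMap ∘L
    (antisymm H n).orthogonalProjectionOnto

/-- The inclusion `Fₙ → H^{⊗ n}`. -/
def sectorIncl (n : ℕ) : Sector H n →L[ℂ] TPow H n :=
  (antisymm H n).subtypeL ∘L
    (sectorEquiv H n).symm.toContinuousLinearEquiv.toContinuousLinearMap

theorem sectorIncl_mem (n : ℕ) (x : Sector H n) : sectorIncl n x ∈ antisymm H n :=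
  ((sectorEquiv H n).symm x).2

theorem inner_antisymmProj (n : ℕ) (x : Sector H n) (y : TPow H n) :
    inner ℂ x (antisymmProj n y) = inner ℂ (sectorIncl n x) y :=
  Submodule.inner_orthogonalProjectionOnto_eq_of_mem_left ((sectorEquiv H n).symm x) y

/-- `f₁ ∧ ⋯ ∧ fₙ = Pₙ (f₁ ⊗ ⋯ ⊗ fₙ)`. -/
def wedge {n : ℕ} (v : Fin n → H) : Sector H n := antisymmProj n (tprod n v)

theorem inner_tprod_tprod {n : ℕ} (v w : Fin n → H) :
    inner ℂ (tprod n v) (tprod n w) = ∏ i, inner ℂ (v i) (w i) := by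
  induction n with
  | zero =>
    have : (inner ℂ (tprod 0 v) (tprod 0 w) : ℂ) = inner ℂ (1 : ℂ) (1 : ℂ) := rfl
    rw [this]; simp
  | succ n ih =>
    rw [tprod_succ, tprod_succ, inner_tensorLeft, ih, Fin.prod_univ_succ]
    rfl

/-- The antisymmetrization formula
`f₁ ∧ ⋯ ∧ fₙ = (n!)⁻¹ ∑_σ sgn(σ) f_{σ(1)} ⊗ ⋯ ⊗ f_{σ(n)}`. -/
theorem sectorIncl_wedge {n : ℕ} (v : Fin n → H) :
    sectorIncl n (wedge v) = ((n.factorial : ℂ)⁻¹) • ∑ σ : Equiv.Perm (Fin n),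
      ((Equiv.Perm.sign σ : ℤ) : ℂ) • tprod n (v ∘ σ) := by
  have key : (antisymm H n).starProjection (tprod n v) =
      ((n.factorial : ℂ)⁻¹) • ∑ σ : Equiv.Perm (Fin n),
        ((Equiv.Perm.sign σ : ℤ) : ℂ) • tprod n (v ∘ σ) := by
    refine Submodule.eq_starProjection_of_mem_of_inner_eq_zero ?_ ?_
    · refine Submodule.smul_mem _ _ ?_
      intro τ w
      simp only [inner_sum, inner_smul_right, inner_tprod_tprod]
      rw [Finset.mul_sum, ← Equiv.sum_comp (Equiv.mulRight τ)]
      refine Finset.sum_congr rfl fun σ _ => ?_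
      rw [← Equiv.prod_comp τ (fun i => inner ℂ (w i) ((v ∘ σ) i))]
      simp only [Equiv.coe_mulRight, map_mul, Units.val_mul, Int.cast_mul, Function.comp_apply,
        Equiv.Perm.coe_mul]
      ring
    · intro ψ hψ
      rw [inner_sub_left, inner_smul_left, sum_inner]
      simp only [inner_smul_left, hψ _ v]
      have h : ∀ σ : Equiv.Perm (Fin n), (starRingEnd ℂ) ((Equiv.Perm.sign σ : ℤ) : ℂ) *
          (((Equiv.Perm.sign σ : ℤ) : ℂ) * inner ℂ (tprod n v) ψ) = inner ℂ (tprod n v) ψ := by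
        intro σ
        rcases Int.units_eq_one_or (Equiv.Perm.sign σ) with h | h <;> simp [h]
      simp only [h, Finset.sum_const, Finset.card_univ, Fintype.card_perm, Fintype.card_fin]
      have : (n.factorial : ℂ) ≠ 0 := by exact_mod_cast n.factorial_ne_zero
      simp [this]
  exact key

/-- `a(f)` from `Fₙ₊₁` to `Fₙ`: `√(n+1)` times the contraction of the first variable with `f`. -/
def sectorAnnihilation (f : H) (n : ℕ) : Sector H (n + 1) →L[ℂ] Sector H n :=
  ((√((n : ℝ) + 1) : ℝ) : ℂ) •
    ((sectorEquiv H n).toContinuousLinearEquiv.toContinuousLinearMap ∘L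
      (contract n f ∘L sectorIncl (n + 1)).codRestrict (antisymm H n)
        fun ψ => contract_mem f (sectorIncl_mem (n + 1) ψ))

theorem sectorIncl_sectorAnnihilation (f : H) (n : ℕ) (ψ : Sector H (n + 1)) :
    sectorIncl n (sectorAnnihilation f n ψ) =
      ((√((n : ℝ) + 1) : ℝ) : ℂ) • contract n f (sectorIncl (n + 1) ψ) := rfl

theorem norm_sectorAnnihilation_le (f : H) (n : ℕ) (ψ : Sector H (n + 1)) :
    ‖sectorAnnihilation f n ψ‖ ≤ ‖f‖ * ‖ψ‖ := by
  have h := sqrt_mul_norm_contract_le f (sectorIncl_mem (n + 1) ψ)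
  have h1 : ‖sectorAnnihilation f n ψ‖ = ‖sectorIncl n (sectorAnnihilation f n ψ)‖ := rfl
  rw [h1, sectorIncl_sectorAnnihilation, norm_smul, Complex.norm_real,
    Real.norm_of_nonneg (Real.sqrt_nonneg _)]
  exact h

theorem sectorAnnihilation_sum_le (f : H) (ψ : lp (fun n => Sector H n) 2) (s : Finset ℕ) :
    ∑ n ∈ s, ‖sectorAnnihilation f n (ψ (n + 1))‖ ^ (2 : ENNReal).toReal ≤
      (‖f‖ * ‖ψ‖) ^ (2 : ENNReal).toReal := by
  have h2 : (0 : ℝ) < (2 : ENNReal).toReal := by norm_num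
  have hsum : Summable fun n => ‖ψ n‖ ^ (2 : ENNReal).toReal := (lp.memℓp ψ).summable h2
  have hsum' : Summable fun n => ‖ψ (n + 1)‖ ^ (2 : ENNReal).toReal :=
    (summable_nat_add_iff 1).mpr hsum
  calc ∑ n ∈ s, ‖sectorAnnihilation f n (ψ (n + 1))‖ ^ (2 : ENNReal).toReal
      ≤ ∑ n ∈ s, ‖f‖ ^ (2 : ENNReal).toReal * ‖ψ (n + 1)‖ ^ (2 : ENNReal).toReal := by
        refine Finset.sum_le_sum fun n _ => ?_
        rw [← Real.mul_rpow (norm_nonneg _) (norm_nonneg _)]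
        exact Real.rpow_le_rpow (norm_nonneg _) (norm_sectorAnnihilation_le f n _) h2.le
    _ = ‖f‖ ^ (2 : ENNReal).toReal * ∑ n ∈ s, ‖ψ (n + 1)‖ ^ (2 : ENNReal).toReal := by
        rw [Finset.mul_sum]
    _ ≤ ‖f‖ ^ (2 : ENNReal).toReal * ‖ψ‖ ^ (2 : ENNReal).toReal := by
        refine mul_le_mul_of_nonneg_left ?_ (by positivity)
        rw [lp.norm_rpow_eq_tsum h2]
        refine (hsum'.sum_le_tsum s fun _ _ => by positivity).trans ?_
        rw [hsum.tsum_eq_zero_add]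
        exact le_add_of_nonneg_left (by positivity)
    _ = (‖f‖ * ‖ψ‖) ^ (2 : ENNReal).toReal := by
        rw [Real.mul_rpow (norm_nonneg _) (norm_nonneg _)]

/-- The annihilation operator `a(f)` on Fock space, in the `n`-th component
`(a(f) ψ)ₙ(x₁, …, xₙ) = √(n+1) ∫ conj (f x) ψₙ₊₁(x, x₁, …, xₙ) dx`. -/
def annihilation (f : H) : Fock H →L[ℂ] Fock H :=
  (fockEquiv H).toContinuousLinearEquiv.toContinuousLinearMap ∘L
    LinearMap.mkContinuous
      { toFun := fun ψ : lp (fun n => Sector H n) 2 =>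
          (⟨fun n => sectorAnnihilation f n (ψ (n + 1)),
            memℓp_gen' (sectorAnnihilation_sum_le f ψ)⟩ : lp (fun n => Sector H n) 2)
        map_add' := fun φ ψ =>
          lp.ext (funext fun n => map_add (sectorAnnihilation f n) (φ (n + 1)) (ψ (n + 1)))
        map_smul' := fun c ψ =>
          lp.ext (funext fun n => map_smul (sectorAnnihilation f n) c (ψ (n + 1))) }
      ‖f‖ (fun ψ => lp.norm_le_of_forall_sum_le (by norm_num) (by positivity)
        (sectorAnnihilation_sum_le f ψ)) ∘L
    (fockEquiv H).symm.toContinuousLinearEquiv.toContinuousLinearMap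

theorem annihilation_apply (f : H) (ψ : Fock H) (n : ℕ) :
    sectorEval n (annihilation f ψ) = sectorAnnihilation f n (sectorEval (n + 1) ψ) := rfl

/-- The creation operator `a*(f)`, the adjoint of `a(f)`. -/
def creation (f : H) : Fock H →L[ℂ] Fock H := ContinuousLinearMap.adjoint (annihilation f)

theorem creation_apply_zero (f : H) (ψ : Fock H) : sectorEval 0 (creation f ψ) = 0 := by
  refine ext_inner_left ℂ fun φ => ?_
  rw [← inner_sectorEmb_left, creation, ContinuousLinearMap.adjoint_inner_right, inner_zero_right]
  have : annihilation f (sectorEmb 0 φ) = 0 := fock_ext fun n => by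
    rw [annihilation_apply, sectorEval_sectorEmb_ne (Nat.succ_ne_zero n), map_zero, map_zero]
  rw [this, inner_zero_left]

/-- On the sectors, the creation operator is `a*(f) ψ = √(n+1) Pₙ₊₁ (f ⊗ ψ)`. -/
theorem creation_apply_succ (f : H) (ψ : Fock H) (n : ℕ) :
    sectorEval (n + 1) (creation f ψ) = ((√((n : ℝ) + 1) : ℝ) : ℂ) •
      antisymmProj (n + 1) (tensorLeft n f (sectorIncl n (sectorEval n ψ))) := by
  refine ext_inner_left ℂ fun φ => ?_
  rw [← inner_sectorEmb_left, creation, ContinuousLinearMap.adjoint_inner_right]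
  have : annihilation f (sectorEmb (n + 1) φ) = sectorEmb n (sectorAnnihilation f n φ) :=
    fock_ext fun m => by
      rw [annihilation_apply]
      by_cases h : m = n
      · subst h; rw [sectorEval_sectorEmb_self, sectorEval_sectorEmb_self]
      · rw [sectorEval_sectorEmb_ne h, sectorEval_sectorEmb_ne (by simpa using h), map_zero]
  have h2 : ∀ x y : Sector H n, inner ℂ x y = inner ℂ (sectorIncl n x) (sectorIncl n y) :=
    fun _ _ => rfl
  rw [this, inner_sectorEmb_left, inner_smul_right, inner_antisymmProj, h2,
    sectorIncl_sectorAnnihilation, inner_smul_left, Complex.conj_ofReal, ← inner_conj_symm,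
    inner_contract, inner_conj_symm]

/-- The local number operator `n(f) = a*(f) a(f)`. -/
def numberOp (f : H) : Fock H →L[ℂ] Fock H := creation f * annihilation f

/-- The orthogonal projection `Πₙ` of Fock space onto the `n`-particle space. -/
def sectorProj (n : ℕ) : Fock H →L[ℂ] Fock H := sectorEmb n ∘L sectorEval n

/-- The restriction `B|_{Fₙ}` of an operator on Fock space (if `B` does not map `Fₙ` to `Fₙ`, its
compression to `Fₙ`). -/
def restrictSector (n : ℕ) (B : Fock H →L[ℂ] Fock H) : Sector H n →L[ℂ] Sector H n :=
  sectorEval n ∘L B ∘L sectorEmb n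

/-- The seminorm `‖A‖ₙ = ‖A Πₙ‖`. -/
def sectorSeminorm (n : ℕ) (A : Fock H →L[ℂ] Fock H) : ℝ := ‖A ∘L sectorProj n‖

variable (H)

/-- The CAR algebra: the C*-algebra generated by all `a(f)`. -/
def carAlgebra : StarSubalgebra ℂ (Fock H →L[ℂ] Fock H) :=
  (StarAlgebra.adjoin ℂ (Set.range (annihilation (H := H)))).topologicalClosure

/-- The particle number preserving CAR algebra `𝔄₀`: the elements of the CAR algebra that map every
`Fₙ` into itself. -/
def carZero : Set (Fock H →L[ℂ] Fock H) :=
  {A | A ∈ carAlgebra H ∧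
    ∀ (n : ℕ) (ψ : Sector H n) (m : ℕ), m ≠ n → sectorEval m (A (sectorEmb n ψ)) = 0}

/-- The closure of `𝔄₀` in the bounded operators on Fock space for the locally convex topology
given by the seminorms `‖·‖ₙ`, `n ≥ 0`. -/
def carZeroHat : Set (Fock H →L[ℂ] Fock H) :=
  {A | ∀ (N : ℕ) (ε : ℝ), 0 < ε → ∃ B ∈ carZero H, ∀ n ≤ N, sectorSeminorm n (A - B) < ε}

variable {H}

/-- The operator `A₁ ⊗ ⋯ ⊗ Aₙ` on `H^{⊗ n}`. -/
def opTprod : (n : ℕ) → (Fin n → (H →L[ℂ] H)) → (TPow H n →L[ℂ] TPow H n)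
  | 0, _ => ContinuousLinearMap.id ℂ _
  | n + 1, A => opTensor (A 0) (opTprod n (Fin.tail A))

/-- The compression `Pₙ B Pₙ` of an operator on `H^{⊗ n}` to an operator on `Fₙ`. -/
def compress {n : ℕ} (B : TPow H n →L[ℂ] TPow H n) : Sector H n →L[ℂ] Sector H n :=
  antisymmProj n ∘L B ∘L sectorIncl n

/-- `A₁ ∧ ⋯ ∧ Aₙ = (n!)⁻¹ ∑_σ A_{σ(1)} ⊗ ⋯ ⊗ A_{σ(n)}` as an operator on `Fₙ`. (The sum maps `Fₙ`
into `Fₙ`, so that the projection in `compress` only changes the codomain.) -/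
def wedgeOp {n : ℕ} (A : Fin n → (H →L[ℂ] H)) : Sector H n →L[ℂ] Sector H n :=
  compress (((n.factorial : ℂ)⁻¹) • ∑ σ : Equiv.Perm (Fin n), opTprod n (A ∘ σ))

/-- The algebra `𝔎ₙ`: the C*-algebra of operators on `Fₙ` generated by the operators
`C₁ ∧ ⋯ ∧ C_k ∧ 1 ∧ ⋯ ∧ 1`, `0 ≤ k ≤ n`, with all `C_i` compact. -/
def sectorAlgebra (H : Type) [NormedAddCommGroup H] [InnerProductSpace ℂ H] (n : ℕ) :
    StarSubalgebra ℂ (Sector H n →L[ℂ] Sector H n) :=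
  (StarAlgebra.adjoin ℂ {T | ∃ (k : ℕ) (C : Fin n → (H →L[ℂ] H)), k ≤ n ∧
    (∀ i : Fin n, (i : ℕ) < k → IsCompactOperator (C i)) ∧
    (∀ i : Fin n, k ≤ (i : ℕ) → C i = ContinuousLinearMap.id ℂ H) ∧
    T = wedgeOp C}).topologicalClosure

/-- The operator `1 ⊗ ⋯ ⊗ 1 ⊗ B` (with `k` factors `1`) on `H^{⊗ (m+k)}`. -/
def idTensorPow {m : ℕ} (B : TPow H m →L[ℂ] TPow H m) :
    (k : ℕ) → (TPow H (m + k) →L[ℂ] TPow H (m + k))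
  | 0 => B
  | k + 1 => opTensor (ContinuousLinearMap.id ℂ H) (idTensorPow B k)

/-- The operator `C ∧ 1_k` on `F_{m+k}`, for an operator `C` on `F_m`: the compression to
`F_{m+k}` of the tensor product of `C` (extended by zero from `F_m` to `H^{⊗ m}`)
with `k` identities. By antisymmetry the order of the factors is immaterial. -/
def wedgeIdAdd {m : ℕ} (C : Sector H m →L[ℂ] Sector H m) (k : ℕ) :
    Sector H (m + k) →L[ℂ] Sector H (m + k) :=
  compress (idTensorPow (sectorIncl m ∘L C ∘L antisymmProj m) k)

/-- The operator `C ∧ 1_{n-m}` on `Fₙ`, for an operator `C` on `F_m` with `m ≤ n`. -/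
def wedgeId {m n : ℕ} (h : m ≤ n) (C : Sector H m →L[ℂ] Sector H m) :
    Sector H n →L[ℂ] Sector H n :=
  (Nat.add_sub_of_le h) ▸ wedgeIdAdd C (n - m)

/-- `K = ∑_{m=0}^n C⁽ᵐ⁾ ∧ 1_{n-m}` with all `C⁽ᵐ⁾` compact. -/
def IsSectorDecomposition (n : ℕ) (C : (m : ℕ) → (Sector H m →L[ℂ] Sector H m))
    (K : Sector H n →L[ℂ] Sector H n) : Prop :=
  (∀ m ≤ n, IsCompactOperator (C m)) ∧
    K = ∑ m : Fin (n + 1), wedgeId (Nat.lt_succ_iff.mp m.2) (C m)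

/-- `κ_{n+1}(K) = L`, where `κ_{n+1}` maps `∑_{m=0}^{n+1} C⁽ᵐ⁾ ∧ 1_{n+1-m}`, with `C⁽ᵐ⁾` compact, to
`∑_{m=0}^n ((n+1-m)/(n+1)) C⁽ᵐ⁾ ∧ 1_{n-m}`. That is, `K` has such a decomposition, and every such
decomposition of `K` gives the value `L`. -/
def KappaEq (n : ℕ) (K : Sector H (n + 1) →L[ℂ] Sector H (n + 1))
    (L : Sector H n →L[ℂ] Sector H n) : Prop :=
  (∃ C, IsSectorDecomposition (n + 1) C K) ∧
    ∀ C, IsSectorDecomposition (n + 1) C K →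
      L = ∑ m : Fin (n + 1),
        (((n + 1 - m : ℂ)) / (n + 1)) • wedgeId (Nat.lt_succ_iff.mp m.2) (C m)

/-- The inverse limit `𝔎`: bounded sequences `(Kₙ)ₙ` with `Kₙ ∈ 𝔎ₙ` that are coherent, i.e.
`κₙ(Kₙ) = Kₙ₋₁` for all `n ≥ 1`. -/
def coherentSequences (H : Type) [NormedAddCommGroup H] [InnerProductSpace ℂ H] :
    Set ((n : ℕ) → (Sector H n →L[ℂ] Sector H n)) :=
  {K | (∀ n, K n ∈ sectorAlgebra H n) ∧ (∀ n, KappaEq n (K (n + 1)) (K n)) ∧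
    BddAbove (Set.range fun n => ‖K n‖)}

/-- `n(f₁) ⋯ n(f_k)`, for a sequence `f₁, f₂, …` given as `f 0, f 1, …`. -/
def numberProd (f : ℕ → H) (k : ℕ) : Fock H →L[ℂ] Fock H :=
  ((List.range k).map fun i => numberOp (f i)).prod

/-- `Aₙ = ∑_{k=1}^n (-1)^k n(f₁) ⋯ n(f_k)|_{Fₙ}`. -/
def alternatingNumberSum (f : ℕ → H) (n : ℕ) : Sector H n →L[ℂ] Sector H n :=
  ∑ k ∈ Finset.Icc 1 n, (-1 : ℂ) ^ k • restrictSector n (numberProd f k)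

end Fock

/-- The one-particle space `L²(ℝᵈ)`. -/
abbrev OneParticle (d : ℕ) : Type :=
  MeasureTheory.Lp ℂ 2 (MeasureTheory.volume : MeasureTheory.Measure (EuclideanSpace ℝ (Fin d)))

end FermiFock

end

open FermiFock

open scoped TensorProduct

noncomputable section

namespace FermiFock

variable {H : Type} [NormedAddCommGroup H] [InnerProductSpace ℂ H]

/-! With sequences indexed from 0, put p_k = n(f_0)⋯n(f_{k-1}) (`numberProd`) and S_N = ∑_{k=1}^N
(-1)^k p_k (`fockNumberSum`). By the anticommutation relations the n(f_i) are commuting projections,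
so the p_k decrease and S_N = -(p_1-p_2)-(p_3-p_4)-⋯ is minus a projection. Hence ‖S_N‖ ≤ 1, and
wedges of the f_i, being joint eigenvectors, have eigenvalue 0 or -1. Since p_k vanishes on F_n for
k > n, every S_N with N ≥ n restricts to A_n on F_n. So A agrees with S_N ∈ 𝔄₀ on the first sectors
and lies in the seminorm closure.

A stays away from the CAR algebra because the pairs b_n = a(f_n)a(f_{n+2}) asymptotically commute in
norm with every element of it (`tendsto_commutator`): an even product passes any a(g), and its
commutator with a*(g) has coefficients tending to 0 by Bessel. On a state with f_0,…,f_n and f_{n+2}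
filled, however, b_n shortens the initial run of filled modes from n+1 to n. The eigenvalue of A
depends on the parity of this run, so ‖[b_n, A]‖ ≥ 1 (`one_le_norm_commutator`), and the distance is
at least 1/2.

For coherence, p_k on F_n equals binom(n,k) times (p_k on F_k) ∧ 1
(`restrictSector_numberProd_eq_wedgeId`), and the weights of κ turn binom(n+1,k) into binom(n,k).
That κ does not depend on the chosen decomposition follows from an intrinsic description: κ(K) is
the weak limit of a(f_j) K a*(f_j) (`kappaLimit_wedgeId`, `KappaLimit.unique`). Membership in 𝔎_n
holds because n(f) on F_n is n times |f⟩⟨f| ∧ 1 ∧ ⋯ ∧ 1.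

Orthonormal sequences, not bases, are the natural setting: the inductions on particle number split
off f_0 and continue with the shifted sequence. -/

/-! ### Creation and annihilation between sectors; the anticommutation relations. -/

theorem sectorIncl_injective (n : ℕ) : Function.Injective (sectorIncl (H := H) n) :=
  fun _ _ h => Subtype.ext h

theorem inner_sectorIncl {n : ℕ} (x y : Sector H n) :
    inner ℂ (sectorIncl n x) (sectorIncl n y) = inner ℂ x y := rfl

theorem antisymmProj_sectorIncl {n : ℕ} (x : Sector H n) :
    antisymmProj n (sectorIncl n x) = x := by
  refine ext_inner_left ℂ fun y => ?_
  rw [inner_antisymmProj, inner_sectorIncl]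

theorem antisymmProj_surjective (n : ℕ) : Function.Surjective (antisymmProj (H := H) n) :=
  fun x => ⟨_, antisymmProj_sectorIncl x⟩

theorem sectorIncl_antisymmProj {n : ℕ} {y : TPow H n} (hy : y ∈ antisymm H n) :
    sectorIncl n (antisymmProj n y) = y := by
  obtain ⟨x, rfl⟩ : ∃ x, sectorIncl n x = y := ⟨sectorEquiv H n ⟨y, hy⟩, rfl⟩
  rw [antisymmProj_sectorIncl]

theorem inner_antisymmProj_left {n : ℕ} (x : Sector H n) (y : TPow H n) :
    inner ℂ (antisymmProj n y) x = inner ℂ y (sectorIncl n x) := by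
  rw [← inner_conj_symm, inner_antisymmProj, inner_conj_symm]

theorem inner_compress {n : ℕ} (B : TPow H n →L[ℂ] TPow H n) (x y : Sector H n) :
    inner ℂ x (compress B y) = inner ℂ (sectorIncl n x) (B (sectorIncl n y)) :=
  inner_antisymmProj n x _

/-- On antisymmetric tensors the alternating insertion is `(n+1)` times the antisymmetrized
tensor product. -/
theorem succ_smul_antisymmProj_tensorLeft (g : H) {n : ℕ} {ψ : TPow H n}
    (hψ : ψ ∈ antisymm H n) :
    ((n : ℂ) + 1) • sectorIncl (n + 1) (antisymmProj (n + 1) (tensorLeft n g ψ)) =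
      insertAlt g n ψ := by
  have : ((n : ℂ) + 1) • antisymmProj (n + 1) (tensorLeft n g ψ) =
      antisymmProj (n + 1) (insertAlt g n ψ) := by
    refine ext_inner_right ℂ fun x => ?_
    rw [inner_smul_left, inner_antisymmProj_left, inner_antisymmProj_left,
      inner_insertAlt g ψ (sectorIncl_mem _ x)]
    simp
  rw [← map_smul, this, sectorIncl_antisymmProj (insertAlt_mem g hψ)]

theorem sqrt_succ_mul_self (n : ℕ) :
    ((√((n : ℝ) + 1) : ℝ) : ℂ) * ((√((n : ℝ) + 1) : ℝ) : ℂ) = (n : ℂ) + 1 := by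
  rw [← Complex.ofReal_mul, Real.mul_self_sqrt (by positivity)]
  push_cast; rfl

theorem sqrt_succ_ne_zero (n : ℕ) : ((√((n : ℝ) + 1) : ℝ) : ℂ) ≠ 0 := by
  have : (0 : ℝ) < √((n : ℝ) + 1) := Real.sqrt_pos.mpr (by positivity)
  exact_mod_cast this.ne'

/-- `a*(f)` from `Fₙ` to `Fₙ₊₁`. -/
def sectorCreation (f : H) (n : ℕ) : Sector H n →L[ℂ] Sector H (n + 1) :=
  ContinuousLinearMap.adjoint (sectorAnnihilation f n)

theorem sectorCreation_eq (f : H) (n : ℕ) (x : Sector H n) :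
    sectorCreation f n x =
      ((√((n : ℝ) + 1) : ℝ) : ℂ) • antisymmProj (n + 1) (tensorLeft n f (sectorIncl n x)) := by
  refine ext_inner_left ℂ fun y => ?_
  rw [sectorCreation, ContinuousLinearMap.adjoint_inner_right, inner_smul_right,
    inner_antisymmProj, ← inner_sectorIncl, sectorIncl_sectorAnnihilation, inner_smul_left,
    Complex.conj_ofReal, ← inner_conj_symm, inner_contract, inner_conj_symm]

/-- Clearing the square root turns a*(f) into the alternating insertion, whose contractions obey a
simple recursion. -/
theorem sqrt_smul_sectorIncl_sectorCreation (f : H) (n : ℕ) (x : Sector H n) :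
    ((√((n : ℝ) + 1) : ℝ) : ℂ) • sectorIncl (n + 1) (sectorCreation f n x) =
      insertAlt f n (sectorIncl n x) := by
  rw [sectorCreation_eq, map_smul, smul_smul, sqrt_succ_mul_self,
    succ_smul_antisymmProj_tensorLeft f (sectorIncl_mem n x)]

theorem sectorAnnihilation_anticomm (f g : H) (n : ℕ) (x : Sector H (n + 2)) :
    sectorAnnihilation f n (sectorAnnihilation g (n + 1) x) =
      -sectorAnnihilation g n (sectorAnnihilation f (n + 1) x) := by
  apply sectorIncl_injective
  simp only [map_neg, sectorIncl_sectorAnnihilation, map_smul]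
  rw [contract_anticomm f g (sectorIncl_mem _ x)]
  simp only [smul_neg]

theorem sectorIncl_sectorAnnihilation_sectorCreation (f g : H) (n : ℕ) (x : Sector H n) :
    sectorIncl n (sectorAnnihilation f n (sectorCreation g n x)) =
      contract n f (insertAlt g n (sectorIncl n x)) := by
  rw [sectorIncl_sectorAnnihilation, ← map_smul, sqrt_smul_sectorIncl_sectorCreation]

theorem sectorAnnihilation_sectorCreation_zero (f g : H) (x : Sector H 0) :
    sectorAnnihilation f 0 (sectorCreation g 0 x) = (inner ℂ f g : ℂ) • x := by
  apply sectorIncl_injective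
  rw [sectorIncl_sectorAnnihilation_sectorCreation, insertAlt, contract_tensorLeft, map_smul]

/-- The recursion `contract_insertAlt` is already the anticommutation relation: contracting the
inserted vector gives the scalar term, contracting an old one the other term with a sign. -/
theorem sectorAnnihilation_sectorCreation_succ (f g : H) (n : ℕ) (x : Sector H (n + 1)) :
    sectorAnnihilation f (n + 1) (sectorCreation g (n + 1) x) =
      (inner ℂ f g : ℂ) • x - sectorCreation g n (sectorAnnihilation f n x) := by
  apply sectorIncl_injective
  rw [sectorIncl_sectorAnnihilation_sectorCreation, contract_insertAlt, map_sub, map_smul]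
  congr 1
  rw [← smul_right_inj (sqrt_succ_ne_zero n), sqrt_smul_sectorIncl_sectorCreation,
    sectorIncl_sectorAnnihilation, map_smul]

theorem sectorEval_creation_succ (f : H) (ψ : Fock H) (n : ℕ) :
    sectorEval (n + 1) (creation f ψ) = sectorCreation f n (sectorEval n ψ) := by
  rw [creation_apply_succ, sectorCreation_eq]

theorem fock_mul_apply (A B : Fock H →L[ℂ] Fock H) (ψ : Fock H) : (A * B) ψ = A (B ψ) := rfl

theorem eq_zero_of_eq_neg_self {V : Type*} [AddCommGroup V] [Module ℂ V] {x : V}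
    (h : x = -x) : x = 0 := by
  have h2 : (2 : ℂ) • x = 0 := by
    rw [two_smul]; nth_rewrite 1 [h]; exact neg_add_cancel x
  exact (smul_eq_zero.mp h2).resolve_left two_ne_zero

theorem annihilation_mul_annihilation (f g : H) :
    annihilation f * annihilation g = -(annihilation g * annihilation f) := by
  ext1 ψ
  refine fock_ext fun n => ?_
  simp only [fock_mul_apply, neg_apply, map_neg, annihilation_apply]
  exact sectorAnnihilation_anticomm f g n _

/-- The canonical anticommutation relation `a(f) a*(g) + a*(g) a(f) = ⟨f, g⟩`. -/
theorem annihilation_mul_creation (f g : H) :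
    annihilation f * creation g =
      (inner ℂ f g : ℂ) • (1 : Fock H →L[ℂ] Fock H) - creation g * annihilation f := by
  ext1 ψ
  refine fock_ext fun n => ?_
  simp only [fock_mul_apply, sub_apply, smul_apply, map_sub,
    annihilation_apply, sectorEval_creation_succ, one_apply_eq_self, map_smul]
  cases n with
  | zero => rw [sectorAnnihilation_sectorCreation_zero, creation_apply_zero, sub_zero]
  | succ n =>
    rw [sectorAnnihilation_sectorCreation_succ, sectorEval_creation_succ, annihilation_apply]

theorem star_annihilation (f : H) : star (annihilation f) = creation f := rfl

theorem star_creation (f : H) : star (creation f) = annihilation f := by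
  rw [← star_annihilation, star_star]

theorem creation_mul_creation (f g : H) :
    creation f * creation g = -(creation g * creation f) := by
  rw [← star_annihilation, ← star_annihilation, ← star_mul, annihilation_mul_annihilation,
    star_neg, star_mul]

theorem creation_mul_self (f : H) : creation f * creation f = 0 :=
  eq_zero_of_eq_neg_self (creation_mul_creation f f)

theorem norm_annihilation_le (f : H) : ‖annihilation f‖ ≤ ‖f‖ := by
  refine ContinuousLinearMap.opNorm_le_bound _ (norm_nonneg _) fun ψ => ?_
  exact lp.norm_le_of_forall_sum_le (by norm_num) (by positivity) (sectorAnnihilation_sum_le f ψ)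

theorem annihilation_sectorEmb_zero (f : H) (x : Sector H 0) :
    annihilation f (sectorEmb 0 x) = 0 := fock_ext fun n => by
  rw [annihilation_apply, sectorEval_sectorEmb_ne (Nat.succ_ne_zero n), map_zero, map_zero]

theorem annihilation_sectorEmb_succ (f : H) (n : ℕ) (x : Sector H (n + 1)) :
    annihilation f (sectorEmb (n + 1) x) = sectorEmb n (sectorAnnihilation f n x) :=
  fock_ext fun m => by
    rw [annihilation_apply]
    by_cases h : m = n
    · subst h; rw [sectorEval_sectorEmb_self, sectorEval_sectorEmb_self]
    · rw [sectorEval_sectorEmb_ne h, sectorEval_sectorEmb_ne (by simpa using h), map_zero]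

theorem creation_sectorEmb (f : H) (n : ℕ) (x : Sector H n) :
    creation f (sectorEmb n x) = sectorEmb (n + 1) (sectorCreation f n x) :=
  fock_ext fun m => by
    cases m with
    | zero => rw [creation_apply_zero, sectorEval_sectorEmb_ne (Nat.succ_ne_zero n).symm]
    | succ m =>
      rw [sectorEval_creation_succ]
      by_cases h : m = n
      · subst h; rw [sectorEval_sectorEmb_self, sectorEval_sectorEmb_self]
      · rw [sectorEval_sectorEmb_ne h, sectorEval_sectorEmb_ne (by simpa using h), map_zero]

/-! ### Particle number preserving operators -/

/-- `B` maps every `Fₙ` into itself. -/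
def PreservesSectors (B : Fock H →L[ℂ] Fock H) : Prop :=
  ∀ (n : ℕ) (x : Sector H n), B (sectorEmb n x) = sectorEmb n (restrictSector n B x)

theorem restrictSector_apply (n : ℕ) (B : Fock H →L[ℂ] Fock H) (x : Sector H n) :
    restrictSector n B x = sectorEval n (B (sectorEmb n x)) := rfl

theorem preservesSectors_of_exists {B : Fock H →L[ℂ] Fock H}
    (h : ∀ (n : ℕ) (x : Sector H n), ∃ y : Sector H n, B (sectorEmb n x) = sectorEmb n y) :
    PreservesSectors B := fun n x => by
  obtain ⟨y, hy⟩ := h n x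
  rw [restrictSector_apply, hy, sectorEval_sectorEmb_self]

theorem PreservesSectors.one : PreservesSectors (1 : Fock H →L[ℂ] Fock H) :=
  preservesSectors_of_exists fun _ x => ⟨x, rfl⟩

theorem PreservesSectors.mul {B C : Fock H →L[ℂ] Fock H} (hB : PreservesSectors B)
    (hC : PreservesSectors C) : PreservesSectors (B * C) :=
  preservesSectors_of_exists fun n x => ⟨_, by rw [fock_mul_apply, hC, hB]⟩

theorem PreservesSectors.smul {B : Fock H →L[ℂ] Fock H} (c : ℂ) (hB : PreservesSectors B) :
    PreservesSectors (c • B) :=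
  preservesSectors_of_exists fun n x => ⟨_, by rw [smul_apply, hB, ← map_smul]⟩

theorem PreservesSectors.sum {ι : Type*} (s : Finset ι) {B : ι → Fock H →L[ℂ] Fock H}
    (hB : ∀ i ∈ s, PreservesSectors (B i)) : PreservesSectors (∑ i ∈ s, B i) :=
  preservesSectors_of_exists fun n x => ⟨∑ i ∈ s, restrictSector n (B i) x, by
    rw [sum_apply, map_sum]; exact Finset.sum_congr rfl fun i hi => hB i hi n x⟩

theorem restrictSector_mul {C : Fock H →L[ℂ] Fock H} (B : Fock H →L[ℂ] Fock H)
    (hC : PreservesSectors C) (n : ℕ) :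
    restrictSector n (B * C) = restrictSector n B * restrictSector n C := by
  ext1 x
  rw [restrictSector_apply, fock_mul_apply, hC]
  rfl

theorem restrictSector_one (n : ℕ) : restrictSector n (1 : Fock H →L[ℂ] Fock H) = 1 := by
  ext1 x; exact sectorEval_sectorEmb_self n x

theorem restrictSector_sum {ι : Type*} (s : Finset ι) (B : ι → Fock H →L[ℂ] Fock H) (n : ℕ) :
    restrictSector n (∑ i ∈ s, B i) = ∑ i ∈ s, restrictSector n (B i) := by
  ext1 x
  simp [restrictSector_apply, sum_apply]

theorem restrictSector_smul (c : ℂ) (B : Fock H →L[ℂ] Fock H) (n : ℕ) :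
    restrictSector n (c • B) = c • restrictSector n B := by
  ext1 x
  simp [restrictSector_apply]

theorem norm_sectorEmb (n : ℕ) (x : Sector H n) : ‖sectorEmb n x‖ = ‖x‖ :=
  lp.norm_single (E := fun n => Sector H n) (by norm_num) n x

theorem norm_sectorEval_le (n : ℕ) (ψ : Fock H) : ‖sectorEval n ψ‖ ≤ ‖ψ‖ :=
  lp.norm_apply_le_norm (E := fun n => Sector H n) (by norm_num) ψ n

theorem norm_restrictSector_le (n : ℕ) (B : Fock H →L[ℂ] Fock H) :
    ‖restrictSector n B‖ ≤ ‖B‖ := by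
  refine ContinuousLinearMap.opNorm_le_bound _ (norm_nonneg _) fun x => ?_
  rw [restrictSector_apply, ← norm_sectorEmb n x]
  exact (norm_sectorEval_le n _).trans (B.le_opNorm _)

theorem numberOp_preservesSectors (f : H) : PreservesSectors (numberOp f) :=
  preservesSectors_of_exists fun n x => by
    cases n with
    | zero => exact ⟨0, by rw [numberOp, fock_mul_apply, annihilation_sectorEmb_zero]; simp⟩
    | succ n => exact ⟨_, by rw [numberOp, fock_mul_apply, annihilation_sectorEmb_succ,
        creation_sectorEmb]⟩

theorem restrictSector_zero_numberOp (f : H) : restrictSector 0 (numberOp f) = 0 := by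
  ext1 x
  rw [restrictSector_apply, numberOp, fock_mul_apply, annihilation_sectorEmb_zero]; simp

theorem restrictSector_succ_numberOp (f : H) (n : ℕ) :
    restrictSector (n + 1) (numberOp f) = sectorCreation f n ∘L sectorAnnihilation f n := by
  ext1 x
  rw [restrictSector_apply, numberOp, fock_mul_apply, annihilation_sectorEmb_succ,
        creation_sectorEmb, sectorEval_sectorEmb_self]; rfl

theorem star_numberOp (f : H) : star (numberOp f) = numberOp f := by
  rw [numberOp, star_mul, star_annihilation, star_creation]

theorem numberOp_mem_carAlgebra (f : H) : numberOp f ∈ carAlgebra H := by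
  have h : annihilation f ∈ carAlgebra H :=
    StarSubalgebra.le_topologicalClosure _ (StarAlgebra.subset_adjoin ℂ _ ⟨f, rfl⟩)
  exact mul_mem (star_mem h) h

/-! ### Local number operators of an orthonormal sequence -/

/-- By orthogonality a(g) anticommutes with both factors of n(f), and the two signs cancel. -/
theorem commute_numberOp_annihilation {f g : H} (h : inner ℂ g f = (0 : ℂ)) :
    Commute (numberOp f) (annihilation g) := by
  have h1 : annihilation g * creation f = -(creation f * annihilation g) := by
    rw [annihilation_mul_creation, h]; simp
  have h2 := annihilation_mul_annihilation g f
  change numberOp f * annihilation g = annihilation g * numberOp f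
  rw [numberOp, ← mul_assoc, h1, neg_mul, mul_assoc, mul_assoc, h2, mul_neg, neg_neg]

theorem commute_numberOp_creation {f g : H} (h : inner ℂ g f = (0 : ℂ)) :
    Commute (numberOp f) (creation g) := by
  have := (commute_numberOp_annihilation h).star_star
  rwa [star_numberOp, star_annihilation] at this

theorem commute_numberOp {f g : H} (h : inner ℂ g f = (0 : ℂ)) :
    Commute (numberOp f) (numberOp g) :=
  (commute_numberOp_creation h).mul_right (commute_numberOp_annihilation h)

theorem annihilation_mul_creation_of_norm_one {f : H} (hf : ‖f‖ = 1) :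
    annihilation f * creation f = 1 - numberOp f := by
  rw [annihilation_mul_creation, inner_self_eq_norm_sq_to_K, hf, numberOp]; simp

/-- a*a a* = a*(1 - a*a), and a*a* = 0: mode f is filled on the range of a*(f). -/
theorem numberOp_mul_creation {f : H} (hf : ‖f‖ = 1) :
    numberOp f * creation f = creation f := by
  rw [numberOp, mul_assoc, annihilation_mul_creation_of_norm_one hf, mul_sub, mul_one, numberOp,
    ← mul_assoc, creation_mul_self, zero_mul, sub_zero]

theorem numberOp_mul_self {f : H} (hf : ‖f‖ = 1) : numberOp f * numberOp f = numberOp f := by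
  conv_lhs => rw [numberOp.eq_1 f, ← mul_assoc, ← numberOp.eq_1 f, numberOp_mul_creation hf]
  rfl

theorem commute_numberOp_numberOp {ι : Type*} {f : ι → H} (hf : Orthonormal ℂ f) (i j : ι) :
    Commute (numberOp (f i)) (numberOp (f j)) := by
  by_cases h : i = j
  · subst h; exact Commute.refl _
  · exact commute_numberOp (hf.2 (Ne.symm h))

theorem numberProd_zero (f : ℕ → H) : numberProd f 0 = 1 := rfl

theorem numberProd_succ (f : ℕ → H) (k : ℕ) :
    numberProd f (k + 1) = numberProd f k * numberOp (f k) := by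
  simp [numberProd, List.range_succ]

/-- Splitting off the first factor, rather than the last, leaves the product for the shifted
sequence, as the inductions on particle number require. -/
theorem numberProd_succ' (f : ℕ → H) (k : ℕ) :
    numberProd f (k + 1) = numberOp (f 0) * numberProd (fun i => f (i + 1)) k := by
  simp [numberProd, List.range_succ_eq_map, Function.comp_def]

theorem commute_numberProd {f : ℕ → H} {k : ℕ} {B : Fock H →L[ℂ] Fock H}
    (h : ∀ i < k, Commute (numberOp (f i)) B) : Commute (numberProd f k) B := by
  induction k with
  | zero => exact Commute.one_left _
  | succ k ih =>
    rw [numberProd_succ]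
    exact (ih fun i hi => h i (hi.trans k.lt_succ_self)).mul_left (h k k.lt_succ_self)

theorem numberProd_preservesSectors (f : ℕ → H) (k : ℕ) : PreservesSectors (numberProd f k) := by
  induction k with
  | zero => exact PreservesSectors.one
  | succ k ih => rw [numberProd_succ]; exact ih.mul (numberOp_preservesSectors _)

theorem numberProd_mem_carAlgebra (f : ℕ → H) (k : ℕ) : numberProd f k ∈ carAlgebra H := by
  induction k with
  | zero => exact one_mem _
  | succ k ih => rw [numberProd_succ]; exact mul_mem ih (numberOp_mem_carAlgebra _)

theorem star_numberProd {f : ℕ → H} (hf : Orthonormal ℂ f) (k : ℕ) :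
    star (numberProd f k) = numberProd f k := by
  induction k with
  | zero => exact star_one _
  | succ k ih =>
    rw [numberProd_succ, star_mul, ih, star_numberOp]
    exact (commute_numberProd fun i _ => commute_numberOp_numberOp hf i k).symm

theorem numberProd_mul_numberOp {f : ℕ → H} (hf : Orthonormal ℂ f) {i k : ℕ} (h : i < k) :
    numberProd f k * numberOp (f i) = numberProd f k := by
  induction k with
  | zero => exact absurd h (Nat.not_lt_zero i)
  | succ k ih =>
    rw [numberProd_succ, mul_assoc]
    rcases (Nat.lt_succ_iff.mp h).eq_or_lt with rfl | h
    · rw [numberOp_mul_self (hf.1 i)]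
    · rw [(commute_numberOp_numberOp hf k i).eq, ← mul_assoc, ih h]

/-- Each factor of the shorter product is absorbed by the idempotent factor already present: the
products are decreasing projections. -/
theorem numberProd_mul_numberProd {f : ℕ → H} (hf : Orthonormal ℂ f) {j k : ℕ} (h : j ≤ k) :
    numberProd f k * numberProd f j = numberProd f k := by
  induction j with
  | zero => rw [numberProd_zero, mul_one]
  | succ j ih =>
    rw [numberProd_succ, ← mul_assoc, ih (Nat.le_of_succ_le h), numberProd_mul_numberOp hf h]

/-- `∑_{k=1}^N (-1)^k n(f₁) ⋯ n(f_k)` on Fock space. -/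
def fockNumberSum (f : ℕ → H) (N : ℕ) : Fock H →L[ℂ] Fock H :=
  ∑ k ∈ Finset.Icc 1 N, (-1 : ℂ) ^ k • numberProd f k

theorem fockNumberSum_succ (f : ℕ → H) (N : ℕ) :
    fockNumberSum f (N + 1) = fockNumberSum f N + (-1 : ℂ) ^ (N + 1) • numberProd f (N + 1) :=
  Finset.sum_Icc_succ_top (Nat.le_add_left 1 N) _

theorem restrictSector_fockNumberSum (f : ℕ → H) (n : ℕ) :
    restrictSector n (fockNumberSum f n) = alternatingNumberSum f n := by
  simp only [fockNumberSum, restrictSector_sum, restrictSector_smul, alternatingNumberSum]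

theorem star_fockNumberSum {f : ℕ → H} (hf : Orthonormal ℂ f) (N : ℕ) :
    star (fockNumberSum f N) = fockNumberSum f N := by
  simp [fockNumberSum, star_sum, star_smul, star_numberProd hf]

/-- The value is -1 for odd N and 0 for even N; it is the eigenvalue of S_N where p_1,…,p_N all act
as the identity. -/
theorem sum_Icc_neg_one_pow (N : ℕ) :
    ∑ k ∈ Finset.Icc 1 N, (-1 : ℂ) ^ k = ((-1) ^ N - 1) / 2 := by
  induction N with
  | zero => simp
  | succ N ih =>
    rw [Finset.sum_Icc_succ_top (Nat.le_add_left 1 N), ih]; ring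

theorem numberProd_mul_fockNumberSum {f : ℕ → H} (hf : Orthonormal ℂ f) {N k : ℕ} (h : N ≤ k) :
    numberProd f k * fockNumberSum f N = (((-1) ^ N - 1) / 2 : ℂ) • numberProd f k := by
  rw [fockNumberSum, Finset.mul_sum, ← sum_Icc_neg_one_pow, Finset.sum_smul]
  refine Finset.sum_congr rfl fun j hj => ?_
  rw [mul_smul_comm, numberProd_mul_numberProd hf ((Finset.mem_Icc.mp hj).2.trans h)]

theorem fockNumberSum_mul_numberProd {f : ℕ → H} (hf : Orthonormal ℂ f) {N k : ℕ} (h : N ≤ k) :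
    fockNumberSum f N * numberProd f k = (((-1) ^ N - 1) / 2 : ℂ) • numberProd f k := by
  have := congrArg star (numberProd_mul_fockNumberSum hf h)
  rw [star_mul, star_fockNumberSum hf, star_numberProd hf, star_smul, star_numberProd hf] at this
  simpa using this

/-- S_N = -(p_1-p_2)-(p_3-p_4)-⋯, ending in -p_N for odd N, is minus a sum of mutually orthogonal
projections. The induction adds one term at a time, using that p_{N+1} is an eigenspace projection
of S_N. -/
theorem fockNumberSum_mul_self {f : ℕ → H} (hf : Orthonormal ℂ f) (N : ℕ) :
    fockNumberSum f N * fockNumberSum f N = -fockNumberSum f N := by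
  induction N with
  | zero => simp [fockNumberSum]
  | succ N ih =>
    rw [fockNumberSum_succ, add_mul, mul_add, mul_add, ih, mul_smul_comm, smul_mul_assoc,
      fockNumberSum_mul_numberProd hf N.le_succ, numberProd_mul_fockNumberSum hf N.le_succ,
      smul_mul_smul_comm, numberProd_mul_numberProd hf le_rfl, neg_add, add_assoc]
    congr 1
    simp only [smul_smul, Nat.succ_eq_add_one, ← add_smul, ← neg_smul]
    congr 1
    -- With s = (-1)^(N+1) and c = ((-1)^N-1)/2 the coefficient of p_{N+1} in the square is 2sc +
    -- s², which equals -s for both parities.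
    rcases neg_one_pow_eq_or ℂ N with h | h <;> rw [pow_succ, h] <;> norm_num

theorem norm_fockNumberSum_le {f : ℕ → H} (hf : Orthonormal ℂ f) (N : ℕ) :
    ‖fockNumberSum f N‖ ≤ 1 := by
  rw [← norm_neg]
  have h : IsStarProjection (-fockNumberSum f N) := by
    refine ⟨?_, ?_⟩
    · change -fockNumberSum f N * -fockNumberSum f N = -fockNumberSum f N
      rw [neg_mul_neg, fockNumberSum_mul_self hf]
    · change star (-fockNumberSum f N) = -fockNumberSum f N
      rw [star_neg, star_fockNumberSum hf]
  exact IsStarProjection.norm_le _ h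

theorem norm_alternatingNumberSum_le {f : ℕ → H} (hf : Orthonormal ℂ f) (n : ℕ) :
    ‖alternatingNumberSum f n‖ ≤ 1 := by
  rw [← restrictSector_fockNumberSum]
  exact (norm_restrictSector_le n _).trans (norm_fockNumberSum_le hf n)

/-! ### Wedge products as joint eigenvectors of the local number operators -/

/-- Tested against an antisymmetric vector x, both sides pair y with the contraction of x by g,
which is itself antisymmetric and so sees only the projection of y. -/
theorem antisymmProj_tensorLeft_antisymmProj (g : H) (n : ℕ) (y : TPow H n) :
    antisymmProj (n + 1) (tensorLeft n g (sectorIncl n (antisymmProj n y))) =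
      antisymmProj (n + 1) (tensorLeft n g y) := by
  refine ext_inner_right ℂ fun x => ?_
  have h := sectorIncl_antisymmProj (contract_mem g (sectorIncl_mem (n + 1) x))
  rw [inner_antisymmProj_left, inner_antisymmProj_left, ← inner_contract, ← inner_contract, ← h,
    inner_sectorIncl, ← inner_antisymmProj_left]

theorem sectorCreation_wedge {n : ℕ} (v : Fin (n + 1) → H) :
    sectorCreation (v 0) n (wedge (Fin.tail v)) = ((√((n : ℝ) + 1) : ℝ) : ℂ) • wedge v := by
  rw [sectorCreation_eq, wedge, antisymmProj_tensorLeft_antisymmProj]; rfl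

/-- Writing a wedge as a creation operator on a shorter wedge reduces eigenvalue questions to
commutation relations. -/
theorem sectorEmb_wedge {n : ℕ} (v : Fin (n + 1) → H) :
    sectorEmb (n + 1) (wedge v) = ((√((n : ℝ) + 1) : ℝ) : ℂ)⁻¹ •
      creation (v 0) (sectorEmb n (wedge (Fin.tail v))) := by
  rw [creation_sectorEmb, sectorCreation_wedge, map_smul, inv_smul_smul₀ (sqrt_succ_ne_zero n)]

/-- If f_k is the leading factor the eigenvalue is 1; otherwise n(f_k) commutes past the leading
creation operator. Repeated indices make the wedge zero, so only the existence of some c is claimed.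
-/
theorem numberOp_wedge {f : ℕ → H} (hf : Orthonormal ℂ f) (k : ℕ) {n : ℕ} (i : Fin n → ℕ) :
    ∃ c : ℂ, numberOp (f k) (sectorEmb n (wedge (f ∘ i))) = c • sectorEmb n (wedge (f ∘ i)) := by
  induction n with
  | zero =>
    exact ⟨0, by rw [numberOp, fock_mul_apply, annihilation_sectorEmb_zero, map_zero, zero_smul]⟩
  | succ n ih =>
    obtain ⟨c, hc⟩ := ih (Fin.tail i)
    rw [sectorEmb_wedge, Function.comp_apply]
    by_cases h : k = i 0
    · refine ⟨1, ?_⟩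
      rw [map_smul, one_smul, ← fock_mul_apply, ← h, numberOp_mul_creation (hf.1 k)]
    · refine ⟨c, ?_⟩
      rw [map_smul, ← fock_mul_apply, (commute_numberOp_creation (hf.2 (Ne.symm h))).eq,
        fock_mul_apply, show Fin.tail (f ∘ i) = f ∘ Fin.tail i from rfl, hc, map_smul, smul_comm]

theorem numberProd_wedge {f : ℕ → H} (hf : Orthonormal ℂ f) (k : ℕ) {n : ℕ} (i : Fin n → ℕ) :
    ∃ c : ℂ, numberProd f k (sectorEmb n (wedge (f ∘ i))) = c • sectorEmb n (wedge (f ∘ i)) := by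
  induction k with
  | zero => exact ⟨1, by rw [one_smul]; rfl⟩
  | succ k ih =>
    obtain ⟨c, hc⟩ := ih
    obtain ⟨c', hc'⟩ := numberOp_wedge hf k i
    exact ⟨c' * c, by rw [numberProd_succ, fock_mul_apply, hc', map_smul, hc, smul_smul]⟩

/-- The wedge is a joint eigenvector of the p_k, and S_N² = -S_N forces its eigenvalue d to satisfy
d(d+1) = 0 unless the wedge vanishes. -/
theorem fockNumberSum_wedge {f : ℕ → H} (hf : Orthonormal ℂ f) (N : ℕ) {n : ℕ} (i : Fin n → ℕ) :
    fockNumberSum f N (sectorEmb n (wedge (f ∘ i))) = 0 ∨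
      fockNumberSum f N (sectorEmb n (wedge (f ∘ i))) = -sectorEmb n (wedge (f ∘ i)) := by
  set w := sectorEmb n (wedge (f ∘ i)) with hw
  choose c hc using fun k => numberProd_wedge hf k i
  have h1 : fockNumberSum f N w = (∑ k ∈ Finset.Icc 1 N, (-1 : ℂ) ^ k * c k) • w := by
    rw [fockNumberSum, sum_apply, Finset.sum_smul]
    exact Finset.sum_congr rfl fun k _ => by rw [smul_apply, hc, smul_smul]
  generalize ∑ k ∈ Finset.Icc 1 N, (-1 : ℂ) ^ k * c k = d at h1
  have h2 : fockNumberSum f N (fockNumberSum f N w) = -fockNumberSum f N w := by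
    rw [← fock_mul_apply, fockNumberSum_mul_self hf]; rfl
  rw [h1, map_smul, h1, smul_smul, ← neg_smul, ← sub_eq_zero, ← sub_smul] at h2
  rw [h1]
  rcases smul_eq_zero.mp h2 with h | h
  · have h' : d * (d + 1) = 0 := by linear_combination h
    rcases mul_eq_zero.mp h' with h | h
    · left; rw [h, zero_smul]
    · right; rw [eq_neg_of_add_eq_zero_left h, neg_one_smul]
  · left; rw [h, smul_zero]

theorem alternatingNumberSum_wedge {f : ℕ → H} (hf : Orthonormal ℂ f) {n : ℕ} (i : Fin n → ℕ) :
    alternatingNumberSum f n (wedge (f ∘ i)) = 0 ∨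
      alternatingNumberSum f n (wedge (f ∘ i)) = -wedge (f ∘ i) := by
  rw [← restrictSector_fockNumberSum, restrictSector_apply]
  refine (fockNumberSum_wedge hf n i).imp (fun h => ?_) fun h => ?_
  · rw [h, map_zero]
  · rw [h, map_neg, sectorEval_sectorEmb_self]

/-! ### The operator on Fock space and its approximation on sectors -/

/-- A bounded sequence of operators on the sectors defines a bounded operator on Fock space. -/
theorem exists_diagonal (K : (n : ℕ) → (Sector H n →L[ℂ] Sector H n))
    {M : ℝ} (hM : 0 ≤ M) (hK : ∀ n, ‖K n‖ ≤ M) :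
    ∃ A : Fock H →L[ℂ] Fock H, ∀ (ψ : Fock H) (n : ℕ),
      sectorEval n (A ψ) = K n (sectorEval n ψ) := by
  have hle (ψ : lp (fun n => Sector H n) 2) (s : Finset ℕ) :
      ∑ n ∈ s, ‖K n (ψ n)‖ ^ (2 : ENNReal).toReal ≤ (M * ‖ψ‖) ^ (2 : ENNReal).toReal := by
    have h2 : (0 : ℝ) < (2 : ENNReal).toReal := by norm_num
    calc ∑ n ∈ s, ‖K n (ψ n)‖ ^ (2 : ENNReal).toReal
        ≤ ∑ n ∈ s, M ^ (2 : ENNReal).toReal * ‖ψ n‖ ^ (2 : ENNReal).toReal := by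
          refine Finset.sum_le_sum fun n _ => ?_
          rw [← Real.mul_rpow hM (norm_nonneg _)]
          exact Real.rpow_le_rpow (norm_nonneg _) ((K n).le_of_opNorm_le (hK n) _) h2.le
      _ = M ^ (2 : ENNReal).toReal * ∑ n ∈ s, ‖ψ n‖ ^ (2 : ENNReal).toReal := by
          rw [Finset.mul_sum]
      _ ≤ M ^ (2 : ENNReal).toReal * ‖ψ‖ ^ (2 : ENNReal).toReal :=
          mul_le_mul_of_nonneg_left (lp.sum_rpow_le_norm_rpow h2 ψ s) (by positivity)
      _ = (M * ‖ψ‖) ^ (2 : ENNReal).toReal := by rw [Real.mul_rpow hM (norm_nonneg _)]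
  exact ⟨(fockEquiv H).toContinuousLinearEquiv.toContinuousLinearMap ∘L
    LinearMap.mkContinuous
      { toFun := fun ψ : lp (fun n => Sector H n) 2 =>
          (⟨fun n => K n (ψ n), memℓp_gen' (hle ψ)⟩ : lp (fun n => Sector H n) 2)
        map_add' := fun φ ψ => lp.ext (funext fun n => map_add (K n) (φ n) (ψ n))
        map_smul' := fun c ψ => lp.ext (funext fun n => map_smul (K n) c (ψ n)) }
      M (fun ψ => lp.norm_le_of_forall_sum_le (by norm_num) (by positivity) (hle ψ)) ∘L
    (fockEquiv H).symm.toContinuousLinearEquiv.toContinuousLinearMap, fun ψ n => rfl⟩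

/-- a(f_0) commutes with the remaining number operators and can be moved to the far right. In this
sandwich form the inner product acts on one particle less. -/
theorem numberProd_succ_eq {f : ℕ → H} (hf : Orthonormal ℂ f) (k : ℕ) :
    numberProd f (k + 1) =
      creation (f 0) * numberProd (fun i => f (i + 1)) k * annihilation (f 0) := by
  rw [numberProd_succ', numberOp, mul_assoc, mul_assoc]
  congr 1
  exact (commute_numberProd fun i _ =>
    commute_numberOp_annihilation (hf.2 (Nat.succ_ne_zero i).symm)).eq.symm

theorem orthonormal_shift {f : ℕ → H} (hf : Orthonormal ℂ f) :
    Orthonormal ℂ fun i => f (i + 1) :=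
  hf.comp _ (add_left_injective 1)

/-- n particles cannot fill k > n orthonormal modes: each layer of the sandwich removes one factor
and one particle, until a(f) meets the vacuum. -/
theorem numberProd_sectorEmb_eq_zero {f : ℕ → H} (hf : Orthonormal ℂ f) {n k : ℕ} (h : n < k)
    (x : Sector H n) : numberProd f k (sectorEmb n x) = 0 := by
  induction n generalizing f k with
  | zero =>
    obtain ⟨k, rfl⟩ := Nat.exists_eq_succ_of_ne_zero h.ne'
    rw [Nat.succ_eq_add_one, numberProd_succ_eq hf, fock_mul_apply, annihilation_sectorEmb_zero,
      map_zero]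
  | succ n ih =>
    obtain ⟨k, rfl⟩ := Nat.exists_eq_succ_of_ne_zero (Nat.ne_zero_of_lt h)
    rw [Nat.succ_eq_add_one, numberProd_succ_eq hf, fock_mul_apply, annihilation_sectorEmb_succ,
      fock_mul_apply, ih (orthonormal_shift hf) (Nat.lt_of_succ_lt_succ h), map_zero]

theorem fockNumberSum_sectorEmb {f : ℕ → H} (hf : Orthonormal ℂ f) {n N : ℕ} (h : n ≤ N)
    (x : Sector H n) :
    fockNumberSum f N (sectorEmb n x) = sectorEmb n (alternatingNumberSum f n x) := by
  induction N, h using Nat.le_induction with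
  | base =>
    have : PreservesSectors (fockNumberSum f n) := PreservesSectors.sum _ fun k _ =>
      (numberProd_preservesSectors f k).smul _
    rw [this, restrictSector_fockNumberSum]
  | succ N h ih =>
    rw [fockNumberSum_succ, add_apply, ih, smul_apply,
      numberProd_sectorEmb_eq_zero hf (Nat.lt_succ_of_le h), smul_zero, add_zero]

theorem diagonal_sectorEmb {K : (n : ℕ) → (Sector H n →L[ℂ] Sector H n)}
    {A : Fock H →L[ℂ] Fock H}
    (hA : ∀ (ψ : Fock H) (n : ℕ), sectorEval n (A ψ) = K n (sectorEval n ψ))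
    (n : ℕ) (x : Sector H n) : A (sectorEmb n x) = sectorEmb n (K n x) :=
  fock_ext fun m => by
    rw [hA]
    by_cases h : m = n
    · subst h; rw [sectorEval_sectorEmb_self, sectorEval_sectorEmb_self]
    · rw [sectorEval_sectorEmb_ne h, sectorEval_sectorEmb_ne h, map_zero]

theorem fockNumberSum_mem_carZero (f : ℕ → H) (N : ℕ) : fockNumberSum f N ∈ carZero H := by
  refine ⟨sum_mem fun k _ => ?_, fun n x m hm => ?_⟩
  · exact Subalgebra.smul_mem (carAlgebra H).toSubalgebra (numberProd_mem_carAlgebra f k) _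
  · have : PreservesSectors (fockNumberSum f N) := PreservesSectors.sum _ fun k _ =>
      (numberProd_preservesSectors f k).smul _
    rw [this, sectorEval_sectorEmb_ne hm]

theorem sectorSeminorm_eq_zero {n : ℕ} {A : Fock H →L[ℂ] Fock H}
    (h : ∀ x, A (sectorEmb n x) = 0) : sectorSeminorm n A = 0 := by
  have : A ∘L sectorProj n = 0 := by ext1 ψ; exact h _
  rw [sectorSeminorm, this, norm_zero]

theorem mem_carZeroHat_of_diagonal {f : ℕ → H} (hf : Orthonormal ℂ f)
    {A : Fock H →L[ℂ] Fock H} (hA : ∀ (ψ : Fock H) (n : ℕ),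
      sectorEval n (A ψ) = alternatingNumberSum f n (sectorEval n ψ)) : A ∈ carZeroHat H := by
  -- S_N agrees with A on all of F_0,…,F_N, so these seminorms of the difference are exactly zero.
  refine fun N ε hε => ⟨fockNumberSum f N, fockNumberSum_mem_carZero f N, fun n hn => ?_⟩
  rw [sectorSeminorm_eq_zero]
  · exact hε
  · intro x
    rw [sub_apply, diagonal_sectorEmb hA, fockNumberSum_sectorEmb hf hn, sub_self]

theorem carZero_subset_carZeroHat : carZero H ⊆ carZeroHat H := by
  refine fun A hA N ε hε => ⟨A, hA, fun n _ => ?_⟩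
  rw [sectorSeminorm_eq_zero]
  · exact hε
  · intro x; rw [sub_self]; rfl

/-! ### Distance to the CAR algebra -/

open Filter Topology

/-- By Bessel's inequality the squares are summable. -/
theorem tendsto_inner_orthonormal {f : ℕ → H} (hf : Orthonormal ℂ f) (g : H) :
    Tendsto (fun n => (inner ℂ (f n) g : ℂ)) atTop (𝓝 0) := by
  have h := (hf.inner_products_summable (x := g)).tendsto_atTop_zero
  rw [tendsto_zero_iff_norm_tendsto_zero]
  have h2 := h.sqrt
  simpa [Real.sqrt_sq] using h2

/-- Products of two far out annihilation operators asymptotically commute with the CAR algebra. -/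
theorem tendsto_commutator {f : ℕ → H} (hf : Orthonormal ℂ f) {B : Fock H →L[ℂ] Fock H}
    (hB : B ∈ carAlgebra H) :
    Tendsto (fun n => annihilation (f n) * annihilation (f (n + 2)) * B -
      B * (annihilation (f n) * annihilation (f (n + 2)))) atTop (𝓝 0) := by
  set b : ℕ → Fock H →L[ℂ] Fock H := fun n => annihilation (f n) * annihilation (f (n + 2))
    with hb
  have ha1 : ∀ n, ‖annihilation (f n)‖ ≤ 1 := fun n => (norm_annihilation_le _).trans (hf.1 n).le
  have hb1 : ∀ n, ‖b n‖ ≤ 1 := fun n => (norm_mul_le _ _).trans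
    (mul_le_one₀ (ha1 n) (norm_nonneg _) (ha1 _))
  -- This bound, uniform in n, lets the convergence pass to norm limits.
  have hbdd : ∀ C : Fock H →L[ℂ] Fock H, ∀ n, ‖b n * C - C * b n‖ ≤ 2 * ‖C‖ := fun C n => by
    refine (norm_sub_le _ _).trans ?_
    have h1 := norm_mul_le (b n) C
    have h2 := norm_mul_le C (b n)
    nlinarith [hb1 n, norm_nonneg C]
  change Tendsto (fun n => b n * B - B * b n) atTop (𝓝 0)
  have hsub : (StarAlgebra.adjoin ℂ (Set.range (annihilation (H := H))) : Set _) ⊆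
      {C | Tendsto (fun n => b n * C - C * b n) atTop (𝓝 0)} := by
    intro C hC
    induction hC using Algebra.adjoin_induction with
    | mem C hC =>
      rcases hC with ⟨g, rfl⟩ | hC
      -- Two sign changes cancel; a single annihilation operator would only anticommute.
      · have : ∀ n, b n * annihilation g - annihilation g * b n = 0 := fun n => by
          rw [hb, mul_assoc, annihilation_mul_annihilation _ g, mul_neg, ← mul_assoc,
            annihilation_mul_annihilation _ g, neg_mul, neg_neg, mul_assoc, sub_self]
        simp only [Set.mem_ofPred_eq, this, tendsto_const_nhds]
      · obtain ⟨g, hg⟩ := Set.mem_star.mp hC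
        obtain rfl : C = creation g := by rw [← star_star C, ← hg, star_annihilation]
        -- The signs cancel again, and what remains are the scalar terms of the anticommutation
        -- relations, which tend to 0.
        have : ∀ n, b n * creation g - creation g * b n =
            (inner ℂ (f (n + 2)) g : ℂ) • annihilation (f n) -
              (inner ℂ (f n) g : ℂ) • annihilation (f (n + 2)) := fun n => by
          rw [hb, mul_assoc, annihilation_mul_creation, mul_sub, ← mul_assoc (annihilation (f n)),
            annihilation_mul_creation, sub_mul, smul_mul_assoc, mul_smul_comm, one_mul, mul_one,
            mul_assoc]
          abel
        simp only [Set.mem_ofPred_eq, this]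
        have hz : ∀ (u : ℕ → ℂ) (v : ℕ → Fock H →L[ℂ] Fock H), Tendsto u atTop (𝓝 0) →
            (∀ n, ‖v n‖ ≤ 1) → Tendsto (fun n => u n • v n) atTop (𝓝 0) := fun u v hu hv => by
          refine squeeze_zero_norm (fun n => ?_) (tendsto_zero_iff_norm_tendsto_zero.mp hu)
          rw [norm_smul]
          exact mul_le_of_le_one_right (norm_nonneg _) (hv n)
        have ht := tendsto_inner_orthonormal hf g
        simpa using (hz _ _ (ht.comp (tendsto_add_atTop_nat 2)) ha1).sub
          (hz _ _ ht fun n => ha1 (n + 2))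
    | algebraMap r =>
      simp only [Set.mem_ofPred_eq, Algebra.commutes, sub_self, tendsto_const_nhds]
    | add C D _ _ hC hD =>
      have h1 := hC.add hD
      rw [add_zero] at h1
      refine h1.congr fun n => ?_
      rw [mul_add, add_mul]; abel
    | mul C D _ _ hC hD =>
      have h1 := (hC.mul_const D).add (hD.const_mul C)
      rw [zero_mul, mul_zero, add_zero] at h1
      refine h1.congr fun n => ?_
      noncomm_ring
  -- Passage to the closure: an approximant C with ‖B - C‖ < ε/4 changes the commutator by less than
  -- ε/2, uniformly in n.
  rw [Metric.tendsto_atTop]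
  intro ε hε
  obtain ⟨C, hC, hBC⟩ := Metric.mem_closure_iff.mp hB (ε / 4) (by positivity)
  obtain ⟨N, hN⟩ := Metric.tendsto_atTop.mp (hsub hC) (ε / 2) (by positivity)
  refine ⟨N, fun n hn => ?_⟩
  have h1 := hN n hn
  rw [dist_zero_right] at h1 ⊢
  rw [dist_eq_norm] at hBC
  have h2 : b n * B - B * b n = (b n * C - C * b n) + (b n * (B - C) - (B - C) * b n) := by
    noncomm_ring
  rw [h2]
  have h3 := hbdd (B - C) n
  linarith [norm_add_le (b n * C - C * b n) (b n * (B - C) - (B - C) * b n)]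

/-- p_k fixes x for k ≤ m, where the modes are filled, and kills it for m < k ≤ N, where the empty
mode f_m is a factor. Only the parity of the initial run of filled modes survives. -/
theorem fockNumberSum_eigen {f : ℕ → H} {m N : ℕ} (hmN : m ≤ N)
    {x : Fock H} (h1 : ∀ i < m, numberOp (f i) x = x) (h0 : m < N → numberOp (f m) x = 0)
    (hf : Orthonormal ℂ f) :
    fockNumberSum f N x = (((-1) ^ m - 1) / 2 : ℂ) • x := by
  induction N, hmN using Nat.le_induction with
  | base =>
    have h2 : ∀ k ≤ m, numberProd f k x = x := by
      intro k
      induction k with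
      | zero => exact fun _ => rfl
      | succ k ih =>
        intro hk
        rw [numberProd_succ, fock_mul_apply, h1 k hk, ih (Nat.le_of_succ_le hk)]
    rw [fockNumberSum, sum_apply, ← sum_Icc_neg_one_pow, Finset.sum_smul]
    exact Finset.sum_congr rfl fun k hk => by rw [smul_apply, h2 k (Finset.mem_Icc.mp hk).2]
  | succ N h ih =>
    have h2 : numberProd f (N + 1) x = 0 := by
      rw [← numberProd_mul_numberOp hf (Nat.lt_succ_of_le h), fock_mul_apply,
        h0 (Nat.lt_succ_of_le h), map_zero]
    rw [fockNumberSum_succ, add_apply, smul_apply, h2, smul_zero, add_zero,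
      ih fun h' => h0 (h'.trans N.lt_succ_self)]

theorem norm_creation_apply {f : H} (hf : ‖f‖ = 1) {x : Fock H} (hx : numberOp f x = 0) :
    ‖creation f x‖ = ‖x‖ := by
  have h : (inner ℂ (creation f x) (creation f x) : ℂ) = inner ℂ x x := by
    conv_lhs => rw [creation, ContinuousLinearMap.adjoint_inner_left, ← creation, ← fock_mul_apply,
      annihilation_mul_creation_of_norm_one hf, sub_apply, hx, sub_zero]
    rfl
  rw [inner_self_eq_norm_sq_to_K, inner_self_eq_norm_sq_to_K] at h
  have h2 : ‖creation f x‖ ^ 2 = ‖x‖ ^ 2 := by exact_mod_cast h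
  exact (sq_eq_sq₀ (norm_nonneg _) (norm_nonneg _)).mp h2

theorem annihilation_creation_apply {f : H} (hf : ‖f‖ = 1) {x : Fock H} (hx : numberOp f x = 0) :
    annihilation f (creation f x) = x := by
  rw [← fock_mul_apply, annihilation_mul_creation_of_norm_one hf, sub_apply, hx, sub_zero]; rfl

/-- The vectors `f_n ∧ ⋯ ∧ f_1`, normalized, by their properties. -/
theorem exists_filled_state {f : ℕ → H} (hf : Orthonormal ℂ f) (n : ℕ) :
    ∃ x : Sector H n, ‖sectorEmb n x‖ = 1 ∧
      (∀ i < n, numberOp (f i) (sectorEmb n x) = sectorEmb n x) ∧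
      ∀ i, n ≤ i → numberOp (f i) (sectorEmb n x) = 0 := by
  induction n with
  | zero =>
    refine ⟨antisymmProj 0 (tpowZero H 1), ?_, fun i hi => absurd hi (Nat.not_lt_zero i),
      fun i _ => ?_⟩
    · rw [norm_sectorEmb]
      have : ‖antisymmProj 0 (tpowZero H 1)‖ =
        ‖sectorIncl 0 (antisymmProj 0 (tpowZero H 1))‖ := rfl
      rw [this, sectorIncl_antisymmProj (antisymm_zero_mem _), LinearIsometryEquiv.norm_map,
        norm_one]
    · rw [numberOp, fock_mul_apply, annihilation_sectorEmb_zero, map_zero]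
  | succ n ih =>
    obtain ⟨x, hx, h1, h0⟩ := ih
    refine ⟨sectorCreation (f n) n x, ?_, fun i hi => ?_, fun i hi => ?_⟩ <;>
      rw [← creation_sectorEmb]
    · rw [norm_creation_apply (hf.1 n) (h0 n le_rfl), hx]
    · rcases (Nat.lt_succ_iff.mp hi).eq_or_lt with rfl | h
      · rw [← fock_mul_apply, numberOp_mul_creation (hf.1 i)]
      · rw [← fock_mul_apply, (commute_numberOp_creation (hf.2 h.ne')).eq, fock_mul_apply, h1 i h]
    · rw [← fock_mul_apply, (commute_numberOp_creation (hf.2 (Nat.lt_of_succ_le hi).ne)).eq,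
        fock_mul_apply, h0 i (Nat.le_of_succ_le hi), map_zero]

/-- The test vector ψ fills f_0,…,f_n and f_{n+2}, leaving the gap f_{n+1}; the pair of annihilators
takes it to the state φ filling f_0,…,f_{n-1}. The initial run drops from n+1 to n, so the
eigenvalues of A differ by 1. The pair (f_n, f_{n+1}) would preserve the parity and detect nothing.
-/
theorem one_le_norm_commutator {f : ℕ → H} (hf : Orthonormal ℂ f)
    {A : Fock H →L[ℂ] Fock H} (hA : ∀ (ψ : Fock H) (n : ℕ),
      sectorEval n (A ψ) = alternatingNumberSum f n (sectorEval n ψ)) (n : ℕ) :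
    1 ≤ ‖annihilation (f n) * annihilation (f (n + 2)) * A -
      A * (annihilation (f n) * annihilation (f (n + 2)))‖ := by
  have hAe : ∀ (m : ℕ) (x : Sector H m), A (sectorEmb m x) = fockNumberSum f m (sectorEmb m x) :=
    fun m x => by rw [diagonal_sectorEmb hA, fockNumberSum_sectorEmb hf le_rfl]
  obtain ⟨x, hx, h1, h0⟩ := exists_filled_state hf n
  have ho : ∀ {i j : ℕ}, i ≠ j → ∀ y, numberOp (f i) (creation (f j) y) =
      creation (f j) (numberOp (f i) y) := fun h y => by
    rw [← fock_mul_apply, (commute_numberOp_creation (hf.2 h.symm)).eq, fock_mul_apply]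
  set φ := sectorEmb n x with hφ
  have e1 : numberOp (f (n + 2)) (creation (f n) φ) = 0 := by
    rw [ho (by omega), h0 _ (by omega), map_zero]
  have hψ : creation (f (n + 2)) (creation (f n) φ) =
      sectorEmb (n + 2) (sectorCreation (f (n + 2)) (n + 1) (sectorCreation (f n) n x)) := by
    rw [hφ, creation_sectorEmb, creation_sectorEmb]
  set ψ := creation (f (n + 2)) (creation (f n) φ) with hψ'
  have hψn : ‖ψ‖ = 1 := by
    rw [norm_creation_apply (hf.1 _) e1, norm_creation_apply (hf.1 _) (h0 n le_rfl), hx]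
  have hbψ : (annihilation (f n) * annihilation (f (n + 2))) ψ = φ := by
    rw [fock_mul_apply, annihilation_creation_apply (hf.1 _) e1,
      annihilation_creation_apply (hf.1 _) (h0 n le_rfl)]
  have hAφ : A φ = (((-1) ^ n - 1) / 2 : ℂ) • φ := by
    rw [hφ, hAe, fockNumberSum_eigen le_rfl h1 (fun h => absurd h (lt_irrefl n)) hf]
  have hAψ : A ψ = (((-1) ^ (n + 1) - 1) / 2 : ℂ) • ψ := by
    rw [hψ, hAe, ← hψ]
    -- Here the run length is n+1 although ψ has n+2 particles; the empty mode is f_{n+1}.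
    refine fockNumberSum_eigen (Nat.le_succ _) (fun i hi => ?_) (fun _ => ?_) hf
    · rw [hψ', ho (by omega)]
      rcases (Nat.lt_succ_iff.mp hi).eq_or_lt with rfl | h
      · rw [← fock_mul_apply (numberOp _), numberOp_mul_creation (hf.1 i)]
      · rw [ho h.ne, h1 i h]
    · rw [hψ', ho (by omega), ho (by omega), h0 _ (by omega), map_zero, map_zero]
  set b := annihilation (f n) * annihilation (f (n + 2)) with hb
  -- The scalar is ((-1)^(n+1)-1)/2 - ((-1)^n-1)/2 = (-1)^(n+1).
  have key : (b * A - A * b) ψ = (-1 : ℂ) ^ (n + 1) • φ := by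
    rw [sub_apply, fock_mul_apply b A, fock_mul_apply A b, hbψ, hAψ, map_smul, hbψ, hAφ, ← sub_smul]
    congr 1
    ring
  have := (b * A - A * b).le_opNorm ψ
  rwa [key, hψn, mul_one, norm_smul, hx, mul_one, norm_pow, norm_neg, norm_one, one_pow] at this

/-- 1 ≤ ‖[b, A]‖ ≤ ‖[b, B]‖ + 2‖A - B‖, and ‖[b, B]‖ tends to 0 along the sequence of pairs. -/
theorem half_le_norm_sub {f : ℕ → H} (hf : Orthonormal ℂ f)
    {A : Fock H →L[ℂ] Fock H} (hA : ∀ (ψ : Fock H) (n : ℕ),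
      sectorEval n (A ψ) = alternatingNumberSum f n (sectorEval n ψ))
    {B : Fock H →L[ℂ] Fock H} (hB : B ∈ carAlgebra H) : 1 / 2 ≤ ‖A - B‖ := by
  have ht := (tendsto_commutator hf hB).norm
  rw [norm_zero] at ht
  have hle : ∀ n, 1 - 2 * ‖A - B‖ ≤ ‖annihilation (f n) * annihilation (f (n + 2)) * B -
      B * (annihilation (f n) * annihilation (f (n + 2)))‖ := fun n => by
    have h1 := one_le_norm_commutator hf hA n
    have ha1 : ∀ n, ‖annihilation (f n)‖ ≤ 1 :=
      fun n => (norm_annihilation_le _).trans (hf.1 n).le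
    set b := annihilation (f n) * annihilation (f (n + 2)) with hb
    have hb1 : ‖b‖ ≤ 1 := (norm_mul_le _ _).trans (mul_le_one₀ (ha1 n) (norm_nonneg _) (ha1 _))
    have h2 : b * A - A * b = (b * B - B * b) + (b * (A - B) - (A - B) * b) := by noncomm_ring
    rw [h2] at h1
    have h3 := norm_add_le (b * B - B * b) (b * (A - B) - (A - B) * b)
    have h4 := norm_sub_le (b * (A - B)) ((A - B) * b)
    have h5 := norm_mul_le b (A - B)
    have h6 := norm_mul_le (A - B) b
    nlinarith [norm_nonneg (A - B)]
  have := ge_of_tendsto' ht hle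
  linarith

/-! ### Operators `1 ⊗ B` -/

/-- Pairing with g ⊗ χ is contracting with g and then pairing with χ, and the vectors g ⊗ χ are
total. Identities involving 1 ⊗ B are checked this way below. -/
theorem contract_ext {n : ℕ} {x y : TPow H (n + 1)}
    (h : ∀ g, contract n g x = contract n g y) : x = y := by
  have : innerSL ℂ x = innerSL ℂ y := tpow_ext fun g χ => by
    simp only [innerSL_apply_apply]
    rw [← inner_conj_symm, ← inner_contract, h g, inner_contract, inner_conj_symm]
  exact ext_inner_right ℂ fun z => congrArg (fun R => R z) this

theorem inner_opTensor_id_right {n m : ℕ} (B : TPow H n →L[ℂ] TPow H m) (x : TPow H (m + 1))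
    (y : TPow H (n + 1)) :
    inner ℂ x (opTensor (ContinuousLinearMap.id ℂ H) B y) =
      inner ℂ (opTensor (ContinuousLinearMap.id ℂ H) (ContinuousLinearMap.adjoint B) x) y := by
  have : innerSL ℂ (opTensor (ContinuousLinearMap.id ℂ H) B y) =
      innerSL ℂ y ∘L opTensor (ContinuousLinearMap.id ℂ H) (ContinuousLinearMap.adjoint B) := by
    refine tpow_ext fun g χ => ?_
    simp only [innerSL_apply_apply, ContinuousLinearMap.comp_apply, opTensor_tensorLeft,
      ContinuousLinearMap.id_apply]
    rw [← inner_conj_symm, ← inner_contract, contract_opTensor, ← inner_conj_symm y,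
      ← inner_contract, ContinuousLinearMap.adjoint_inner_left]
  have h := congrArg (fun R => starRingEnd ℂ (R x)) this
  simpa only [innerSL_apply_apply, ContinuousLinearMap.comp_apply, inner_conj_symm] using h

theorem norm_opTensor_id_apply_le {n m : ℕ} (B : TPow H n →L[ℂ] TPow H m) (x : TPow H (n + 1)) :
    ‖opTensor (ContinuousLinearMap.id ℂ H) B x‖ ≤ ‖B‖ * ‖x‖ := by
  obtain ⟨y, rfl⟩ := (tpowSucc H n).surjective x
  induction y using UniformSpace.Completion.induction_on with
  | hp => exact isClosed_le (by fun_prop) (by fun_prop)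
  | ih y =>
    have h1 : ‖opTensor (ContinuousLinearMap.id ℂ H) B (tpowSucc H n y)‖ =
        ‖TensorProduct.mapL (ContinuousLinearMap.id ℂ H) B y‖ := by
      simp [opTensor]
    rw [h1, LinearIsometryEquiv.norm_map, UniformSpace.Completion.norm_coe]
    refine ((TensorProduct.mapL _ B).le_opNorm y).trans ?_
    refine mul_le_mul_of_nonneg_right ?_ (norm_nonneg _)
    refine (TensorProduct.norm_mapL_le _ _).trans ?_
    exact mul_le_of_le_one_left (norm_nonneg _) ContinuousLinearMap.norm_id_le

/-- The operator `1 ⊗ K` on `H ⊗ H^{⊗ n}`, for `K` on `Fₙ` extended by zero. -/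
def liftTensor {n m : ℕ} (K : Sector H n →L[ℂ] Sector H m) :
    TPow H (n + 1) →L[ℂ] TPow H (m + 1) :=
  opTensor (ContinuousLinearMap.id ℂ H) (sectorIncl m ∘L K ∘L antisymmProj n)

/-- The operator `K ∧ 1` on `Fₙ₊₁`, for `K` on `Fₙ`. -/
def lift {n : ℕ} (K : Sector H n →L[ℂ] Sector H n) : Sector H (n + 1) →L[ℂ] Sector H (n + 1) :=
  compress (liftTensor K)

theorem contract_liftTensor {n m : ℕ} (K : Sector H n →L[ℂ] Sector H m) (g : H)
    (y : TPow H (n + 1)) :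
    contract m g (liftTensor K y) = sectorIncl m (K (antisymmProj n (contract n g y))) :=
  contract_opTensor g _ y

theorem adjoint_antisymmProj (n : ℕ) :
    ContinuousLinearMap.adjoint (antisymmProj (H := H) n) = sectorIncl n := by
  ext1 x
  refine ext_inner_left ℂ fun y => ?_
  rw [ContinuousLinearMap.adjoint_inner_right, inner_antisymmProj_left]

theorem adjoint_sectorIncl (n : ℕ) :
    ContinuousLinearMap.adjoint (sectorIncl (H := H) n) = antisymmProj n := by
  rw [← adjoint_antisymmProj, ContinuousLinearMap.adjoint_adjoint]

theorem inner_liftTensor_right {n m : ℕ} (K : Sector H n →L[ℂ] Sector H m) (x : TPow H (m + 1))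
    (y : TPow H (n + 1)) :
    inner ℂ x (liftTensor K y) = inner ℂ (liftTensor (ContinuousLinearMap.adjoint K) x) y := by
  rw [liftTensor, inner_opTensor_id_right]
  simp only [liftTensor, ContinuousLinearMap.adjoint_comp, adjoint_antisymmProj,
    adjoint_sectorIncl, ContinuousLinearMap.comp_assoc]

theorem liftTensor_comp {n m k : ℕ} (K : Sector H m →L[ℂ] Sector H k)
    (L : Sector H n →L[ℂ] Sector H m) :
    liftTensor (K ∘L L) = liftTensor K ∘L liftTensor L := by
  ext1 y
  refine contract_ext fun g => ?_
  rw [ContinuousLinearMap.comp_apply, contract_liftTensor, contract_liftTensor,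
    contract_liftTensor, antisymmProj_sectorIncl, ContinuousLinearMap.comp_apply]

theorem liftTensor_smul {n m : ℕ} (c : ℂ) (K : Sector H n →L[ℂ] Sector H m) :
    liftTensor (c • K) = c • liftTensor K := by
  ext1 y
  refine contract_ext fun g => ?_
  simp only [smul_apply, map_smul, contract_liftTensor]

theorem norm_liftTensor_apply_le {n m : ℕ} (K : Sector H n →L[ℂ] Sector H m)
    (x : TPow H (n + 1)) : ‖liftTensor K x‖ ≤ ‖K‖ * ‖x‖ := by
  refine (norm_opTensor_id_apply_le _ x).trans ?_
  refine mul_le_mul_of_nonneg_right ?_ (norm_nonneg _)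
  refine ContinuousLinearMap.opNorm_le_bound _ (norm_nonneg _) fun y => ?_
  have h1 : ‖antisymmProj n y‖ ≤ ‖y‖ := (antisymm H n).norm_orthogonalProjectionOnto_apply_le y
  calc ‖K (antisymmProj n y)‖ ≤ ‖K‖ * ‖antisymmProj n y‖ := K.le_opNorm _
    _ ≤ ‖K‖ * ‖y‖ := mul_le_mul_of_nonneg_left h1 (norm_nonneg _)

theorem inner_lift {n : ℕ} (K : Sector H n →L[ℂ] Sector H n) (x y : Sector H (n + 1)) :
    inner ℂ x (lift K y) = inner ℂ (sectorIncl (n + 1) x) (liftTensor K (sectorIncl (n + 1) y)) :=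
  inner_compress _ x y

theorem lift_smul {n : ℕ} (c : ℂ) (K : Sector H n →L[ℂ] Sector H n) :
    lift (c • K) = c • lift K := by
  simp only [lift, compress, liftTensor_smul, ContinuousLinearMap.smul_comp,
    ContinuousLinearMap.comp_smul]

/-- The operator is 1 ⊗ P_n, not the identity; it fixes tensors that are antisymmetric in the last n
variables. -/
theorem liftTensor_one_sectorIncl {n : ℕ} (y : Sector H (n + 1)) :
    liftTensor (1 : Sector H n →L[ℂ] Sector H n) (sectorIncl (n + 1) y) = sectorIncl (n + 1) y :=
  contract_ext fun g => by
    rw [contract_liftTensor]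
    exact sectorIncl_antisymmProj (contract_mem g (sectorIncl_mem _ y))

theorem lift_one (n : ℕ) : lift (1 : Sector H n →L[ℂ] Sector H n) = 1 := by
  ext1 y
  refine ext_inner_left ℂ fun x => ?_
  rw [inner_lift, liftTensor_one_sectorIncl]; rfl

/-- `1 ⊗ a(h)` agrees with `a(h)` on antisymmetric tensors, up to a constant. -/
theorem liftTensor_sectorAnnihilation (h : H) (n : ℕ) (y : Sector H (n + 2)) :
    liftTensor (sectorAnnihilation h n) (sectorIncl (n + 2) y) =
      (-(((√((n : ℝ) + 1) : ℝ) : ℂ) * ((√(((n + 1 : ℕ) : ℝ) + 1) : ℝ) : ℂ)⁻¹)) •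
        sectorIncl (n + 1) (sectorAnnihilation h (n + 1) y) := by
  refine contract_ext fun g => ?_
  have h1 := sectorIncl_antisymmProj (contract_mem g (sectorIncl_mem (n + 2) y))
  rw [contract_liftTensor, sectorIncl_sectorAnnihilation, h1,
    sectorIncl_sectorAnnihilation, contract_anticomm h g (sectorIncl_mem (n + 2) y), map_smul,
    map_smul, smul_smul, neg_mul, mul_assoc, inv_mul_cancel₀ (sqrt_succ_ne_zero (n + 1)), mul_one,
    neg_smul, smul_neg]

/-- 1 ⊗ a(h) contracts the second variable instead of the first and carries √(n+1) instead of
√(n+2), so on antisymmetric tensors it is -√((n+1)/(n+2)) a(h). This factor enters once from each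
side. -/
theorem lift_comp_sectorAnnihilation {n : ℕ} (h h' : H) (K : Sector H n →L[ℂ] Sector H n) :
    lift (sectorCreation h n ∘L K ∘L sectorAnnihilation h' n) =
      (((n : ℂ) + 1) / ((n : ℂ) + 2)) •
        (sectorCreation h (n + 1) ∘L lift K ∘L sectorAnnihilation h' (n + 1)) := by
  ext1 y
  refine ext_inner_left ℂ fun x => ?_
  rw [inner_lift, liftTensor_comp, ContinuousLinearMap.comp_apply, inner_liftTensor_right,
    liftTensor_comp, ContinuousLinearMap.comp_apply, sectorCreation,
    ContinuousLinearMap.adjoint_adjoint, liftTensor_sectorAnnihilation,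
    liftTensor_sectorAnnihilation, map_smul, inner_smul_left, inner_smul_right, ← inner_lift,
    smul_apply, inner_smul_right, ContinuousLinearMap.comp_apply, ContinuousLinearMap.comp_apply,
    sectorCreation, ContinuousLinearMap.adjoint_inner_right, ← mul_assoc]
  congr 1
  simp only [map_neg, map_mul, map_inv₀, Complex.conj_ofReal]
  have e1 := sqrt_succ_mul_self n
  have e2 := sqrt_succ_mul_self (n + 1)
  have e3 := sqrt_succ_ne_zero (n + 1)
  have e4 : (n : ℂ) + 2 ≠ 0 := by exact_mod_cast (Nat.succ_ne_zero (n + 1))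
  have e5 : (((n + 1 : ℕ) : ℂ) + 1) = (n : ℂ) + 2 := by push_cast; ring
  rw [e5] at e2
  rw [← e1, ← e2]
  field_simp

/-! ### The operators `C ∧ 1` -/

/-- Antisymmetric tensors are invariant under 1 ⊗ P_n, so X may be replaced by P_n X P_n before
compressing. Hence C ∧ 1_{k+1} = (C ∧ 1_k) ∧ 1, the recursion behind all later inductions. -/
theorem compress_opTensor_id {n : ℕ} (X : TPow H n →L[ℂ] TPow H n) :
    compress (opTensor (ContinuousLinearMap.id ℂ H) X) = lift (compress X) := by
  ext1 y
  refine ext_inner_left ℂ fun x => ?_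
  have h : lift (compress X) y = antisymmProj (n + 1) (liftTensor 1
      (opTensor (ContinuousLinearMap.id ℂ H) X (sectorIncl (n + 1) y))) := by
    change antisymmProj (n + 1) (liftTensor (compress X) _) = _
    congr 1
    refine contract_ext fun g => ?_
    rw [contract_liftTensor, contract_liftTensor, contract_opTensor]
    have h1 := sectorIncl_antisymmProj (contract_mem g (sectorIncl_mem _ y))
    exact congrArg (fun z => sectorIncl n (antisymmProj n (X z))) h1
  rw [h, inner_antisymmProj, inner_liftTensor_right, ← ContinuousLinearMap.star_eq_adjoint,
    star_one, liftTensor_one_sectorIncl, inner_compress]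

theorem compress_extend {m : ℕ} (C : Sector H m →L[ℂ] Sector H m) :
    compress (sectorIncl m ∘L C ∘L antisymmProj m) = C := by
  ext1 x
  simp only [compress, ContinuousLinearMap.comp_apply, antisymmProj_sectorIncl]

theorem wedgeIdAdd_zero {m : ℕ} (C : Sector H m →L[ℂ] Sector H m) : wedgeIdAdd C 0 = C :=
  compress_extend C

theorem wedgeIdAdd_succ {m : ℕ} (C : Sector H m →L[ℂ] Sector H m) (k : ℕ) :
    wedgeIdAdd C (k + 1) = lift (wedgeIdAdd C k) :=
  compress_opTensor_id _

theorem wedgeId_eq_wedgeIdAdd {m k : ℕ} (h : m ≤ m + k) (C : Sector H m →L[ℂ] Sector H m) :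
    wedgeId h C = wedgeIdAdd C k := by
  -- Generalizing the exponent (m+k)-m to a variable j lets the cast disappear by substitution.
  have aux : ∀ (j : ℕ) (hj : j = k) (e : m + j = m + k),
      (e ▸ wedgeIdAdd C j : Sector H (m + k) →L[ℂ] Sector H (m + k)) = wedgeIdAdd C k := by
    rintro j rfl e; rfl
  exact aux _ (by omega) _

theorem wedgeId_self {m : ℕ} (h : m ≤ m) (C : Sector H m →L[ℂ] Sector H m) : wedgeId h C = C :=
  (wedgeId_eq_wedgeIdAdd (k := 0) h C).trans (wedgeIdAdd_zero C)

theorem wedgeId_succ {m n : ℕ} (h : m ≤ n) (h' : m ≤ n + 1) (C : Sector H m →L[ℂ] Sector H m) :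
    wedgeId h' C = lift (wedgeId h C) := by
  obtain ⟨k, rfl⟩ := Nat.exists_eq_add_of_le h
  rw [wedgeId_eq_wedgeIdAdd, ← wedgeIdAdd_succ]
  exact wedgeId_eq_wedgeIdAdd (k := k + 1) h' C

/-! ### Number products as multiples of operators `C ∧ 1`. -/

theorem restrictSector_numberProd_succ {f : ℕ → H} (hf : Orthonormal ℂ f) (n k : ℕ) :
    restrictSector (n + 1) (numberProd f (k + 1)) =
      sectorCreation (f 0) n ∘L restrictSector n (numberProd (fun i => f (i + 1)) k) ∘L
        sectorAnnihilation (f 0) n := by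
  ext1 x
  rw [restrictSector_apply, numberProd_succ_eq hf, fock_mul_apply, fock_mul_apply,
    annihilation_sectorEmb_succ, sectorEval_creation_succ]
  rfl

/-- Peeling off the outer pair a*(f_0), a(f_0) lowers n and k by one; the factors from
`lift_comp_sectorAnnihilation` telescope down to `lift 1 = 1`. The constant is
binom(n,k)/binom(n+1,k). -/
theorem lift_numberProd {f : ℕ → H} (hf : Orthonormal ℂ f) {n k : ℕ} (h : k ≤ n) :
    lift (restrictSector n (numberProd f k)) =
      (((n : ℂ) + 1 - k) / ((n : ℂ) + 1)) • restrictSector (n + 1) (numberProd f k) := by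
  induction k generalizing f n with
  | zero =>
    have : (n : ℂ) + 1 ≠ 0 := by exact_mod_cast n.succ_ne_zero
    rw [numberProd_zero, restrictSector_one, restrictSector_one, lift_one, Nat.cast_zero, sub_zero,
      div_self this, one_smul]
  | succ k ih =>
    obtain ⟨n, rfl⟩ := Nat.exists_eq_succ_of_ne_zero (Nat.ne_zero_of_lt h)
    rw [Nat.succ_eq_add_one, restrictSector_numberProd_succ hf, lift_comp_sectorAnnihilation,
      ih (orthonormal_shift hf) (Nat.le_of_succ_le_succ h), restrictSector_numberProd_succ hf,
      ContinuousLinearMap.smul_comp, ContinuousLinearMap.comp_smul, smul_smul]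
    congr 1
    have h1 : (n : ℂ) + 1 ≠ 0 := by exact_mod_cast n.succ_ne_zero
    have h2 : (n : ℂ) + 2 ≠ 0 := by exact_mod_cast n.succ.succ_ne_zero
    have h3 : (n : ℂ) + 1 + 1 ≠ 0 := by rwa [add_assoc, one_add_one_eq_two]
    push_cast
    field_simp
    ring

/-- p_k acts on n particles as the sum, over the binom(n,k) choices of k of them, of p_k on the
chosen ones. The proof compares consecutive n through `lift_numberProd`. -/
theorem restrictSector_numberProd_eq_wedgeId {f : ℕ → H} (hf : Orthonormal ℂ f) {n k : ℕ}
    (h : k ≤ n) :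
    restrictSector n (numberProd f k) =
      (n.choose k : ℂ) • wedgeId h (restrictSector k (numberProd f k)) := by
  induction n, h using Nat.le_induction with
  | base => rw [wedgeId_self, Nat.choose_self, Nat.cast_one, one_smul]
  | succ n h ih =>
    have h1 := lift_numberProd hf h
    rw [ih, lift_smul, ← wedgeId_succ h (Nat.le_succ_of_le h)] at h1
    have h2 : (n : ℂ) + 1 ≠ 0 := by exact_mod_cast n.succ_ne_zero
    have h3 : (n : ℂ) + 1 - k ≠ 0 := by
      have : ((n + 1 - k : ℕ) : ℂ) ≠ 0 := Nat.cast_ne_zero.mpr (by omega)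
      rwa [Nat.cast_sub (by omega), Nat.cast_add, Nat.cast_one] at this
    have h4 : (n.choose k : ℂ) * (n + 1) = (n + 1).choose k * ((n : ℂ) + 1 - k) := by
      have := congrArg (Nat.cast (R := ℂ)) (Nat.choose_mul_succ_eq n k)
      rw [Nat.cast_mul, Nat.cast_mul, Nat.cast_sub (by omega)] at this
      exact_mod_cast this
    rw [← smul_right_inj (div_ne_zero h3 h2), ← h1, smul_smul]
    congr 1
    field_simp
    linear_combination h4

/-- F_0 is one-dimensional, and each sandwich a*(f_0) · a(f_0) preserves compactness. -/
theorem isCompactOperator_restrictSector_numberProd {f : ℕ → H} (hf : Orthonormal ℂ f) (k : ℕ) :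
    IsCompactOperator (restrictSector k (numberProd f k)) := by
  induction k generalizing f with
  | zero =>
    have h1 : FiniteDimensional ℂ (TPow H 0) :=
      (tpowZero H).toLinearEquiv.finiteDimensional
    have h2 : FiniteDimensional ℂ (Sector H 0) :=
      inferInstanceAs (FiniteDimensional ℂ (antisymm H 0))
    have : ProperSpace (Sector H 0) := FiniteDimensional.proper ℂ _
    exact isCompactOperator_of_locallyCompactSpace_dom _
  | succ k ih =>
    rw [restrictSector_numberProd_succ hf]
    exact ((ih (orthonormal_shift hf)).comp_clm (sectorAnnihilation (f 0) k)).clm_comp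
      (sectorCreation (f 0) k)

theorem wedgeId_smul {m n : ℕ} (h : m ≤ n) (c : ℂ) (C : Sector H m →L[ℂ] Sector H m) :
    wedgeId h (c • C) = c • wedgeId h C := by
  induction n, h using Nat.le_induction with
  | base => rw [wedgeId_self, wedgeId_self]
  | succ n h ih => rw [wedgeId_succ h, wedgeId_succ h, ih, lift_smul]

/-- The coefficients of `A_n` in its decomposition into operators `C ∧ 1`. -/
def numberSumCoeff (f : ℕ → H) (n m : ℕ) : Sector H m →L[ℂ] Sector H m :=
  -- The coefficient at m = 0 is zero because the sum defining A_n starts at k = 1.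
  ((if m = 0 then 0 else (-1) ^ m) * n.choose m : ℂ) • restrictSector m (numberProd f m)

theorem wedgeId_numberSumCoeff {f : ℕ → H} (hf : Orthonormal ℂ f) {n m : ℕ} (h : m ≤ n) :
    wedgeId h (numberSumCoeff f n m) =
      (if m = 0 then 0 else (-1) ^ m : ℂ) • restrictSector n (numberProd f m) := by
  rw [numberSumCoeff, wedgeId_smul, mul_smul, ← restrictSector_numberProd_eq_wedgeId hf h]

/-- (n+1-m)/(n+1) · binom(n+1,m) = binom(n,m): the weights of κ take the coefficients of A_{n+1} to
those of A_n. -/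
theorem wedgeId_numberSumCoeff_succ (f : ℕ → H) {n m : ℕ} (h : m ≤ n) :
    (((n : ℂ) + 1 - m) / ((n : ℂ) + 1)) • wedgeId h (numberSumCoeff f (n + 1) m) =
      wedgeId h (numberSumCoeff f n m) := by
  rw [numberSumCoeff, numberSumCoeff, wedgeId_smul, wedgeId_smul, smul_smul]
  congr 1
  have h2 : (n : ℂ) + 1 ≠ 0 := by exact_mod_cast n.succ_ne_zero
  have h4 : (n.choose m : ℂ) * (n + 1) = (n + 1).choose m * ((n : ℂ) + 1 - m) := by
    have := congrArg (Nat.cast (R := ℂ)) (Nat.choose_mul_succ_eq n m)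
    rw [Nat.cast_mul, Nat.cast_mul, Nat.cast_sub (by omega)] at this
    exact_mod_cast this
  rw [div_mul_eq_mul_div, div_eq_iff h2]
  linear_combination (-(if m = 0 then 0 else (-1) ^ m : ℂ)) * h4

theorem alternatingNumberSum_eq_sum_wedgeId {f : ℕ → H} (hf : Orthonormal ℂ f) (n : ℕ) :
    alternatingNumberSum f n =
      ∑ m : Fin (n + 1), wedgeId (Nat.lt_succ_iff.mp m.2) (numberSumCoeff f n m) := by
  simp only [wedgeId_numberSumCoeff hf]
  rw [Fin.sum_univ_eq_sum_range (fun m =>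
      (if m = 0 then 0 else (-1) ^ m : ℂ) • restrictSector n (numberProd f m)) (n + 1),
    Finset.range_eq_Ico, Finset.sum_eq_sum_Ico_succ_bot n.succ_pos, if_pos rfl, zero_smul,
    zero_add]
  refine Finset.sum_congr (by ext; simp [Nat.succ_le_iff]) fun m hm => ?_
  rw [if_neg (Nat.ne_zero_of_lt (Finset.mem_Ico.mp hm).1)]

theorem isSectorDecomposition_alternatingNumberSum {f : ℕ → H} (hf : Orthonormal ℂ f) (n : ℕ) :
    IsSectorDecomposition n (numberSumCoeff f n) (alternatingNumberSum f n) :=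
  ⟨fun m _ => (isCompactOperator_restrictSector_numberProd hf m).smul
    ((if m = 0 then 0 else (-1) ^ m) * n.choose m : ℂ), alternatingNumberSum_eq_sum_wedgeId hf n⟩

/-! ### The map `κ` as a weak limit -/

theorem isClosed_tendsto_zero {E F : Type*} [NormedAddCommGroup E] [NormedSpace ℂ E]
    [NormedAddCommGroup F] [NormedSpace ℂ F] {φ : ℕ → E →L[ℂ] F} {M : ℝ}
    (hM : ∀ j x, ‖φ j x‖ ≤ M * ‖x‖) :
    IsClosed {x | Tendsto (fun j => φ j x) atTop (𝓝 0)} := by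
  refine isClosed_of_closure_subset fun x hx => ?_
  rw [Set.mem_ofPred_eq, Metric.tendsto_atTop]
  intro ε hε
  -- No sign of M is assumed; this supplies a positive constant to divide by.
  have hM' : 0 < |M| + 1 := by positivity
  obtain ⟨y, hy, hxy⟩ := Metric.mem_closure_iff.mp hx (ε / (2 * (|M| + 1))) (by positivity)
  obtain ⟨N, hN⟩ := Metric.tendsto_atTop.mp hy (ε / 2) (by positivity)
  refine ⟨N, fun j hj => ?_⟩
  have h1 := hN j hj
  rw [dist_zero_right] at h1 ⊢
  rw [dist_eq_norm, lt_div_iff₀ (by positivity)] at hxy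
  have h2 : ‖φ j (x - y)‖ ≤ (|M| + 1) * ‖x - y‖ := (hM j _).trans
    (mul_le_mul_of_nonneg_right (by linarith [le_abs_self M]) (norm_nonneg _))
  have h3 : φ j x = φ j y + φ j (x - y) := by rw [← map_add, add_sub_cancel]
  rw [h3]
  linarith [norm_add_le (φ j y) (φ j (x - y))]

theorem tendsto_zero_of_tensorLeft {n : ℕ} {F : Type*} [NormedAddCommGroup F] [NormedSpace ℂ F]
    {φ : ℕ → TPow H (n + 1) →L[ℂ] F} {M : ℝ} (hM : ∀ j x, ‖φ j x‖ ≤ M * ‖x‖)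
    (h : ∀ g ψ, Tendsto (fun j => φ j (tensorLeft n g ψ)) atTop (𝓝 0)) (x : TPow H (n + 1)) :
    Tendsto (fun j => φ j x) atTop (𝓝 0) := by
  obtain ⟨y, rfl⟩ := (tpowSucc H n).surjective x
  induction y using UniformSpace.Completion.induction_on with
  | hp => exact (isClosed_tendsto_zero hM).preimage (tpowSucc H n).continuous
  | ih y =>
    induction y using TensorProduct.induction_on with
    | zero =>
      have h0 : ((0 : H ⊗[ℂ] TPow H n) : UniformSpace.Completion (H ⊗[ℂ] TPow H n)) = 0 :=
        UniformSpace.Completion.coe_zero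
      simp only [h0, map_zero, tendsto_const_nhds]
    | tmul f ψ => exact h f ψ
    | add a b ha hb =>
      simp only [UniformSpace.Completion.coe_add, map_add]
      simpa using ha.add hb

theorem norm_tensorLeft_apply {n : ℕ} (g : H) (ψ : TPow H n) :
    ‖tensorLeft n g ψ‖ = ‖g‖ * ‖ψ‖ := by
  have h := inner_tensorLeft g g ψ ψ
  simp only [inner_self_eq_norm_sq_to_K] at h
  have h2 : ‖tensorLeft n g ψ‖ ^ 2 = (‖g‖ * ‖ψ‖) ^ 2 := by rw [mul_pow]; exact_mod_cast h
  exact (sq_eq_sq₀ (norm_nonneg _) (by positivity)).mp h2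

theorem norm_contract_apply_le {n : ℕ} (g : H) (x : TPow H (n + 1)) :
    ‖contract n g x‖ ≤ ‖g‖ * ‖x‖ := by
  refine ContinuousLinearMap.le_of_opNorm_le _ ?_ x
  rw [contract, LinearIsometryEquiv.norm_map]
  exact ContinuousLinearMap.opNorm_le_bound _ (norm_nonneg _) fun ψ =>
    (norm_tensorLeft_apply g ψ).le

/-- On g ⊗ ψ the contraction is ⟨f_j, g⟩ψ, which tends to 0 by Bessel; the uniform bound extends
this to all tensors. -/
theorem tendsto_contract {f : ℕ → H} (hf : Orthonormal ℂ f) {n : ℕ} (x : TPow H (n + 1)) :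
    Tendsto (fun j => contract n (f j) x) atTop (𝓝 0) := by
  refine tendsto_zero_of_tensorLeft (M := 1) (fun j x => ?_) (fun g ψ => ?_) x
  · exact (norm_contract_apply_le _ x).trans_eq (by rw [hf.1 j])
  · simp only [contract_tensorLeft]
    simpa using (tendsto_inner_orthonormal hf g).smul_const ψ

theorem norm_sectorIncl {n : ℕ} (x : Sector H n) : ‖sectorIncl n x‖ = ‖x‖ := rfl

theorem norm_antisymmProj_le {n : ℕ} (y : TPow H n) : ‖antisymmProj n y‖ ≤ ‖y‖ :=
  (antisymm H n).norm_orthogonalProjectionOnto_apply_le y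

theorem tendsto_sectorAnnihilation {f : ℕ → H} (hf : Orthonormal ℂ f) {n : ℕ}
    (x : Sector H (n + 1)) :
    Tendsto (fun j => sectorAnnihilation (f j) n x) atTop (𝓝 0) := by
  rw [tendsto_zero_iff_norm_tendsto_zero]
  simp only [← norm_sectorIncl, sectorIncl_sectorAnnihilation]
  rw [← tendsto_zero_iff_norm_tendsto_zero]
  simpa using (tendsto_contract hf (sectorIncl (n + 1) x)).const_smul
    ((√((n : ℝ) + 1) : ℝ) : ℂ)

theorem norm_sectorAnnihilation_le_one {f : H} (hf : ‖f‖ = 1) (n : ℕ) :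
    ‖sectorAnnihilation f n‖ ≤ 1 :=
  ContinuousLinearMap.opNorm_le_bound _ zero_le_one fun x =>
    (norm_sectorAnnihilation_le f n x).trans_eq (by rw [hf])

theorem norm_sectorCreation_le_one {f : H} (hf : ‖f‖ = 1) (n : ℕ) :
    ‖sectorCreation f n‖ ≤ 1 := by
  rw [sectorCreation, LinearIsometryEquiv.norm_map]
  exact norm_sectorAnnihilation_le_one hf n

/-- `L` is the weak limit of `a(f_j) K a*(f_j)`. -/
def KappaLimit (f : ℕ → H) {n : ℕ} (K : Sector H (n + 1) →L[ℂ] Sector H (n + 1))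
    (L : Sector H n →L[ℂ] Sector H n) : Prop :=
  ∀ x y : Sector H n, Tendsto
    (fun j => (inner ℂ (sectorCreation (f j) n x) (K (sectorCreation (f j) n y)) : ℂ)) atTop
    (𝓝 (inner ℂ x (L y)))

/-- The limit is formed from K alone, so any two decompositions of K must give the same value of κ.
-/
theorem KappaLimit.unique {f : ℕ → H} {n : ℕ} {K : Sector H (n + 1) →L[ℂ] Sector H (n + 1)}
    {L L' : Sector H n →L[ℂ] Sector H n} (h : KappaLimit f K L) (h' : KappaLimit f K L') :
    L = L' := by
  ext1 y
  exact ext_inner_left ℂ fun x => tendsto_nhds_unique (h x y) (h' x y)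

theorem KappaLimit.add {f : ℕ → H} {n : ℕ} {K K' : Sector H (n + 1) →L[ℂ] Sector H (n + 1)}
    {L L' : Sector H n →L[ℂ] Sector H n} (h : KappaLimit f K L) (h' : KappaLimit f K' L') :
    KappaLimit f (K + K') (L + L') := fun x y => by
  simpa only [add_apply, inner_add_right] using (h x y).add (h' x y)

theorem KappaLimit.zero (f : ℕ → H) (n : ℕ) :
    KappaLimit f (0 : Sector H (n + 1) →L[ℂ] Sector H (n + 1)) 0 := fun x y => by
  simp only [zero_apply, inner_zero_right, tendsto_const_nhds]

theorem KappaLimit.sum {f : ℕ → H} {n : ℕ} {ι : Type*} (s : Finset ι)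
    {K : ι → Sector H (n + 1) →L[ℂ] Sector H (n + 1)}
    {L : ι → Sector H n →L[ℂ] Sector H n} (h : ∀ i ∈ s, KappaLimit f (K i) (L i)) :
    KappaLimit f (∑ i ∈ s, K i) (∑ i ∈ s, L i) := by
  classical
  induction s using Finset.induction_on with
  | empty => exact KappaLimit.zero f n
  | insert i s hi ih =>
    rw [Finset.sum_insert hi, Finset.sum_insert hi]
    exact (h i (Finset.mem_insert_self i s)).add
      (ih fun j hj => h j (Finset.mem_insert_of_mem hj))

/-- The limit vanishes for compact operators, since `a*(f_j) x → 0` weakly. -/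
theorem kappaLimit_zero_of_isCompactOperator {f : ℕ → H} (hf : Orthonormal ℂ f) {n : ℕ}
    {C : Sector H (n + 1) →L[ℂ] Sector H (n + 1)} (hC : IsCompactOperator C) :
    KappaLimit f C 0 := fun x y => by
  rw [zero_apply, inner_zero_right]
  obtain ⟨S, hS, hCS⟩ := IsCompactOperator.image_closedBall_subset_compact
    (f := (C : Sector H (n + 1) →ₗ[ℂ] Sector H (n + 1))) hC ‖y‖
  have hbd : ∀ (j : ℕ) (z : Sector H n), ‖sectorCreation (f j) n z‖ ≤ ‖z‖ := fun j z => by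
    simpa using (sectorCreation (f j) n).le_of_opNorm_le
      (norm_sectorCreation_le_one (hf.1 j) n) z
  have hmem : ∀ j, C (sectorCreation (f j) n y) ∈ S := fun j =>
    hCS ⟨_, by simpa using hbd j y, rfl⟩
  -- Along a further subsequence C a*(f_j)y converges in norm to some a. Then ⟨a*(f_j)x, a⟩ = ⟨x,
  -- a(f_j)a⟩ tends to 0, and the remaining error is bounded by ‖x‖ times a null sequence.
  refine tendsto_of_subseq_tendsto fun ns hns => ?_
  obtain ⟨a, -, ms, hms, ha⟩ := hS.tendsto_subseq fun j => hmem (ns j)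
  refine ⟨ms, ?_⟩
  have hw : Tendsto (fun j => (inner ℂ (sectorCreation (f j) n x) a : ℂ)) atTop (𝓝 0) := by
    simp only [sectorCreation, ContinuousLinearMap.adjoint_inner_left]
    simpa using (tendsto_const_nhds (x := x)).inner (𝕜 := ℂ) (tendsto_sectorAnnihilation hf a)
  have h1 := hw.comp (hns.comp hms.tendsto_atTop)
  have h2 : Tendsto (fun j => (inner ℂ (sectorCreation (f (ns (ms j))) n x)
      (C (sectorCreation (f (ns (ms j))) n y) - a) : ℂ)) atTop (𝓝 0) := by
    have h3 : Tendsto (fun j => ‖x‖ * ‖C (sectorCreation (f (ns (ms j))) n y) - a‖) atTop (𝓝 0) := by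
      simpa using ((ha.sub_const a).norm).const_mul ‖x‖
    refine squeeze_zero_norm (fun j => ?_) h3
    exact (norm_inner_le_norm _ _).trans (mul_le_mul_of_nonneg_right (hbd _ x) (norm_nonneg _))
  have h4 := h1.add h2
  rw [add_zero] at h4
  refine h4.congr fun j => ?_
  change inner ℂ (sectorCreation (f (ns (ms j))) n x) a + _ = _
  rw [← inner_add_right, add_sub_cancel]

/-- For Y = g ⊗ ψ the pairing reduces to one on F_n, where the hypothesis applies; the uniform norm
bound then covers general Y. -/
theorem tendsto_inner_liftTensor {n : ℕ} {T : ℕ → Sector H n →L[ℂ] Sector H n}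
    {L : Sector H n →L[ℂ] Sector H n} {M : ℝ} (hM : ∀ j, ‖T j‖ ≤ M)
    (h : ∀ x y, Tendsto (fun j => (inner ℂ x (T j y) : ℂ)) atTop (𝓝 (inner ℂ x (L y))))
    (X Y : TPow H (n + 1)) :
    Tendsto (fun j => (inner ℂ X (liftTensor (T j) Y) : ℂ)) atTop
      (𝓝 (inner ℂ X (liftTensor L Y))) := by
  have key := tendsto_zero_of_tensorLeft (n := n)
    (φ := fun j => innerSL ℂ X ∘L (liftTensor (T j) - liftTensor L)) (M := ‖X‖ * (M + ‖L‖))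
    (fun j Z => ?_) (fun g ψ => ?_) Y
  · have h2 := key.add_const (inner ℂ X (liftTensor L Y))
    rw [zero_add] at h2
    refine h2.congr fun j => ?_
    rw [ContinuousLinearMap.comp_apply, sub_apply, innerSL_apply_apply, ← inner_add_right,
      sub_add_cancel]
  · rw [ContinuousLinearMap.comp_apply, sub_apply, innerSL_apply_apply, mul_assoc]
    refine (norm_inner_le_norm _ _).trans (mul_le_mul_of_nonneg_left ?_ (norm_nonneg _))
    rw [add_mul]
    refine (norm_sub_le _ _).trans (add_le_add ?_ (norm_liftTensor_apply_le L Z))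
    exact (norm_liftTensor_apply_le _ Z).trans (mul_le_mul_of_nonneg_right (hM j) (norm_nonneg _))
  · have h2 : ∀ K : Sector H n →L[ℂ] Sector H n, inner ℂ X (liftTensor K (tensorLeft n g ψ)) =
        (inner ℂ (antisymmProj n (contract n g X)) (K (antisymmProj n ψ)) : ℂ) := fun K => by
      rw [liftTensor, opTensor_tensorLeft, ← inner_conj_symm, ← inner_contract, inner_conj_symm,
        inner_antisymmProj_left]
      rfl
    simp only [ContinuousLinearMap.comp_apply, sub_apply, innerSL_apply_apply, inner_sub_right, h2]
    have h3 := (h (antisymmProj n (contract n g X)) (antisymmProj n ψ)).sub_const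
      (inner ℂ (antisymmProj n (contract n g X)) (L (antisymmProj n ψ)))
    rwa [sub_self] at h3

/-- The alternating insertion consists of the term with e in front and the terms keeping the first
variable in place; the latter form 1 ⊗ a*(e), up to normalization. -/
theorem sqrt_smul_sectorIncl_sectorCreation_succ (e : H) (n : ℕ) (x : Sector H (n + 1)) :
    ((√(((n + 1 : ℕ) : ℝ) + 1) : ℝ) : ℂ) • sectorIncl (n + 2) (sectorCreation e (n + 1) x) =
      tensorLeft (n + 1) e (sectorIncl (n + 1) x) - ((√((n : ℝ) + 1) : ℝ) : ℂ) •
        liftTensor (sectorCreation e n) (sectorIncl (n + 1) x) := by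
  rw [sqrt_smul_sectorIncl_sectorCreation, insertAlt, sub_apply]
  congr 1
  refine contract_ext fun g => ?_
  have h1 := sectorIncl_antisymmProj (contract_mem g (sectorIncl_mem _ x))
  rw [contract_opTensor, map_smul, contract_liftTensor, sqrt_smul_sectorIncl_sectorCreation, h1]

theorem liftTensor_tensorLeft {n m : ℕ} (K : Sector H n →L[ℂ] Sector H m) (e : H)
    (x : Sector H n) :
    liftTensor K (tensorLeft n e (sectorIncl n x)) = tensorLeft m e (sectorIncl m (K x)) := by
  rw [liftTensor, opTensor_tensorLeft, ContinuousLinearMap.comp_apply,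
    ContinuousLinearMap.comp_apply, antisymmProj_sectorIncl]; rfl

theorem inner_self_eq_one_of_norm {e : H} (he : ‖e‖ = 1) : (inner ℂ e e : ℂ) = 1 := by
  rw [inner_self_eq_norm_sq_to_K, he]; simp

/-- On F_0 the vector a*(f_j)z is just f_j ⊗ z, so the sequence is constant. -/
theorem kappaLimit_lift_zero {f : ℕ → H} (hf : Orthonormal ℂ f)
    (K : Sector H 0 →L[ℂ] Sector H 0) : KappaLimit f (lift K) K := fun x y => by
  have h : ∀ (j : ℕ) (z : Sector H 0), sectorIncl 1 (sectorCreation (f j) 0 z) =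
      tensorLeft 0 (f j) (sectorIncl 0 z) := fun j z => by
    have := sqrt_smul_sectorIncl_sectorCreation (f j) 0 z
    simpa [insertAlt] using this
  refine tendsto_const_nhds.congr fun j => ?_
  rw [inner_lift, h, h, liftTensor_tensorLeft, inner_tensorLeft,
    inner_self_eq_one_of_norm (hf.1 j), one_mul, inner_sectorIncl]

/-- Split a*(f_j) on both sides of 1 ⊗ K into its front term and 1 ⊗ a*(f_j). The two front terms
give ⟨x, Ky⟩, the mixed terms u and v vanish in the limit, and the last term w is 1 ⊗ a(f_j)K
a*(f_j), converging to L ∧ 1. The normalizations contribute n+2 on the left and n+1 for w. -/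
theorem KappaLimit.lift {f : ℕ → H} (hf : Orthonormal ℂ f) {n : ℕ}
    {K : Sector H (n + 1) →L[ℂ] Sector H (n + 1)} {L : Sector H n →L[ℂ] Sector H n}
    (h : KappaLimit f K L) :
    KappaLimit f (FermiFock.lift K)
      (((n : ℂ) + 2)⁻¹ • (K + ((n : ℂ) + 1) • FermiFock.lift L)) := fun x y => by
  set r : ℂ := ((√((n : ℝ) + 1) : ℝ) : ℂ) with hr
  set q : ℂ := ((√(((n + 1 : ℕ) : ℝ) + 1) : ℝ) : ℂ) with hq
  have hrr : r * r = (n : ℂ) + 1 := sqrt_succ_mul_self n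
  have hqq : q * q = (n : ℂ) + 2 := (sqrt_succ_mul_self (n + 1)).trans (by push_cast; ring)
  have hrc : (starRingEnd ℂ) r = r := Complex.conj_ofReal _
  have hqc : (starRingEnd ℂ) q = q := Complex.conj_ofReal _
  have hn2 : (n : ℂ) + 2 ≠ 0 := by exact_mod_cast n.succ.succ_ne_zero
  set u : ℕ → ℂ := fun j => inner ℂ (sectorIncl (n + 1) x) (sectorIncl (n + 1)
    (K (sectorCreation (f j) n (antisymmProj n (contract n (f j) (sectorIncl (n + 1) y)))))) with hu
  set v : ℕ → ℂ := fun j => inner ℂ (sectorIncl (n + 1) (sectorCreation (f j) n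
    (antisymmProj n (contract n (f j) (sectorIncl (n + 1) x))))) (sectorIncl (n + 1) (K y)) with hv
  set w : ℕ → ℂ := fun j => inner ℂ (sectorIncl (n + 1) x)
    (liftTensor (sectorAnnihilation (f j) n ∘L K ∘L sectorCreation (f j) n) (sectorIncl (n + 1) y))
    with hw
  have key : ∀ j, (inner ℂ (sectorCreation (f j) (n + 1) x)
      (FermiFock.lift K (sectorCreation (f j) (n + 1) y)) : ℂ) =
        ((n : ℂ) + 2)⁻¹ * (inner ℂ x (K y) - r * u j - r * v j + ((n : ℂ) + 1) * w j) := by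
    intro j
    rw [eq_inv_mul_iff_mul_eq₀ hn2, inner_lift, ← hqq]
    have e1 : q * q * inner ℂ (sectorIncl (n + 1 + 1) (sectorCreation (f j) (n + 1) x))
        (liftTensor K (sectorIncl (n + 1 + 1) (sectorCreation (f j) (n + 1) y))) =
        (inner ℂ (q • sectorIncl (n + 1 + 1) (sectorCreation (f j) (n + 1) x))
          (liftTensor K (q • sectorIncl (n + 1 + 1) (sectorCreation (f j) (n + 1) y))) : ℂ) := by
      rw [map_smul, inner_smul_left, inner_smul_right, hqc, mul_assoc]
    have e2 : inner ℂ (tensorLeft (n + 1) (f j) (sectorIncl (n + 1) x))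
        (liftTensor K (liftTensor (sectorCreation (f j) n) (sectorIncl (n + 1) y))) = u j := by
      rw [← inner_contract, contract_liftTensor, contract_liftTensor, antisymmProj_sectorIncl]
    have e3 : inner ℂ (liftTensor (sectorCreation (f j) n) (sectorIncl (n + 1) x))
        (tensorLeft (n + 1) (f j) (sectorIncl (n + 1) (K y))) = v j := by
      rw [← inner_conj_symm, ← inner_contract, contract_liftTensor, inner_conj_symm]
    have e4 : inner ℂ (liftTensor (sectorCreation (f j) n) (sectorIncl (n + 1) x))
        (liftTensor K (liftTensor (sectorCreation (f j) n) (sectorIncl (n + 1) y))) = w j := by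
      simp only [hw]
      rw [liftTensor_comp, liftTensor_comp, ContinuousLinearMap.comp_apply,
        inner_liftTensor_right (sectorAnnihilation (f j) n)]
      rfl
    have e5 : (inner ℂ (tensorLeft (n + 1) (f j) (sectorIncl (n + 1) x))
        (tensorLeft (n + 1) (f j) (sectorIncl (n + 1) (K y))) : ℂ) = inner ℂ x (K y) := by
      rw [inner_tensorLeft, inner_self_eq_one_of_norm (hf.1 j), one_mul, inner_sectorIncl]
    rw [e1, sqrt_smul_sectorIncl_sectorCreation_succ, sqrt_smul_sectorIncl_sectorCreation_succ,
      map_sub, map_smul, liftTensor_tensorLeft, inner_sub_left, inner_sub_right, inner_sub_right,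
      inner_smul_left, inner_smul_right, inner_smul_left, inner_smul_right, ← hr, hrc, e2, e3, e4,
      e5, ← hrr]
    ring
  -- In a mixed term f_j is contracted against a fixed vector, which tends to 0 in norm, while
  -- ‖a*(f_j)‖ ≤ 1.
  have hs : ∀ z : Sector H (n + 1), Tendsto (fun j => sectorCreation (f j) n
      (antisymmProj n (contract n (f j) (sectorIncl (n + 1) z)))) atTop (𝓝 0) := fun z => by
    refine squeeze_zero_norm (fun j => ?_)
      (tendsto_zero_iff_norm_tendsto_zero.mp (tendsto_contract hf (sectorIncl (n + 1) z)))
    refine ((sectorCreation (f j) n).le_of_opNorm_le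
      (norm_sectorCreation_le_one (hf.1 j) n) _).trans ?_
    rw [one_mul]
    exact norm_antisymmProj_le _
  have hu0 : Tendsto u atTop (𝓝 0) := by
    have := (tendsto_const_nhds (x := sectorIncl (n + 1) x)).inner (𝕜 := ℂ)
      (((sectorIncl (n + 1) ∘L K).continuous.tendsto 0).comp (hs y))
    rwa [map_zero, inner_zero_right] at this
  have hv0 : Tendsto v atTop (𝓝 0) := by
    have := (((sectorIncl (n + 1)).continuous.tendsto 0).comp (hs x)).inner (𝕜 := ℂ)
      (tendsto_const_nhds (x := sectorIncl (n + 1) (K y)))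
    rwa [map_zero, inner_zero_left] at this
  have hw0 : Tendsto w atTop (𝓝 (inner ℂ x (FermiFock.lift L y))) := by
    rw [inner_lift]
    refine tendsto_inner_liftTensor (M := ‖K‖) (fun j => ?_) (fun a b => ?_) _ _
    · have h1 := norm_sectorAnnihilation_le_one (hf.1 j) n
      have h2 := norm_sectorCreation_le_one (hf.1 j) n
      calc _ ≤ ‖sectorAnnihilation (f j) n‖ * ‖K ∘L sectorCreation (f j) n‖ :=
            ContinuousLinearMap.opNorm_comp_le _ _
        _ ≤ 1 * (‖K‖ * 1) := by
            refine mul_le_mul h1 ?_ (norm_nonneg _) zero_le_one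
            exact (ContinuousLinearMap.opNorm_comp_le _ _).trans
              (mul_le_mul_of_nonneg_left h2 (norm_nonneg _))
        _ = ‖K‖ := by ring
    · refine (h a b).congr fun j => ?_
      rw [sectorCreation, ContinuousLinearMap.adjoint_inner_left]; rfl
  simp only [key]
  have := ((((tendsto_const_nhds (x := (inner ℂ x (K y) : ℂ))).sub (hu0.const_mul r)).sub
    (hv0.const_mul r)).add (hw0.const_mul ((n : ℂ) + 1))).const_mul (((n : ℂ) + 2)⁻¹)
  simpa only [smul_apply, add_apply, inner_smul_right, inner_add_right, mul_zero, sub_zero]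
    using this

/-- For n = m compactness makes the limit of C itself zero, and `KappaLimit.lift` leaves C/(m+1).
Each further ∧ 1 gives (1 + (n+1-m))/(n+2) = (n+2-m)/(n+2). -/
theorem kappaLimit_wedgeId {f : ℕ → H} (hf : Orthonormal ℂ f) {m n : ℕ} (h : m ≤ n)
    (h' : m ≤ n + 1) {C : Sector H m →L[ℂ] Sector H m} (hC : IsCompactOperator C) :
    KappaLimit f (wedgeId h' C) ((((n : ℂ) + 1 - m) / ((n : ℂ) + 1)) • wedgeId h C) := by
  induction n, h using Nat.le_induction with
  | base =>
    rw [wedgeId_succ le_rfl, wedgeId_self]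
    -- For m = 0 there is no sector below on which a limit of C could be formed, so this case is
    -- computed directly.
    cases m with
    | zero => simpa using kappaLimit_lift_zero hf C
    | succ m =>
      have := (kappaLimit_zero_of_isCompactOperator hf hC).lift hf
      have h0 : lift (0 : Sector H m →L[ℂ] Sector H m) = 0 := by
        simpa using lift_smul 0 (0 : Sector H m →L[ℂ] Sector H m)
      rw [h0, smul_zero, add_zero] at this
      convert this using 2
      push_cast
      rw [add_assoc, one_add_one_eq_two, ← one_div]
      congr 1
      ring
  | succ n h ih =>
    rw [wedgeId_succ (Nat.le_succ_of_le h)]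
    convert (ih (Nat.le_succ_of_le h)).lift hf using 1
    rw [lift_smul, ← wedgeId_succ h (Nat.le_succ_of_le h), smul_smul]
    nth_rewrite 2 [← one_smul ℂ (wedgeId _ C)]
    rw [← add_smul, smul_smul]
    congr 1
    have h1 : (n : ℂ) + 1 ≠ 0 := by exact_mod_cast n.succ_ne_zero
    have h2 : (n : ℂ) + 2 ≠ 0 := by exact_mod_cast n.succ.succ_ne_zero
    have h3 : (n : ℂ) + 1 + 1 ≠ 0 := by rwa [add_assoc, one_add_one_eq_two]
    push_cast
    field_simp
    ring

/-- The top term m = n+1 is compact on F_{n+1} and contributes 0, matching its weight in κ; the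
others are given by `kappaLimit_wedgeId`. -/
theorem kappaLimit_of_isSectorDecomposition {f : ℕ → H} (hf : Orthonormal ℂ f) {n : ℕ}
    {C : (m : ℕ) → (Sector H m →L[ℂ] Sector H m)}
    {K : Sector H (n + 1) →L[ℂ] Sector H (n + 1)} (h : IsSectorDecomposition (n + 1) C K) :
    KappaLimit f K (∑ m : Fin (n + 1),
      (((n + 1 - m : ℂ)) / (n + 1)) • wedgeId (Nat.lt_succ_iff.mp m.2) (C m)) := by
  have h1 : K = ∑ m : Fin (n + 1), wedgeId (m := (m : ℕ)) m.2.le (C m) + C (n + 1) := by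
    rw [h.2, Fin.sum_univ_castSucc]
    exact congrArg _ (wedgeId_self le_rfl (C (n + 1)))
  rw [h1]
  have h2 := (KappaLimit.sum Finset.univ fun (m : Fin (n + 1)) _ =>
    kappaLimit_wedgeId hf (Nat.lt_succ_iff.mp m.2) m.2.le (h.1 m m.2.le)).add
      (kappaLimit_zero_of_isCompactOperator hf (h.1 (n + 1) le_rfl))
  rwa [add_zero] at h2

theorem kappaEq_alternatingNumberSum {f : ℕ → H} (hf : Orthonormal ℂ f) (n : ℕ) :
    KappaEq n (alternatingNumberSum f (n + 1)) (alternatingNumberSum f n) := by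
  have h0 := isSectorDecomposition_alternatingNumberSum hf (n + 1)
  refine ⟨⟨_, h0⟩, fun C hC => ?_⟩
  rw [← (kappaLimit_of_isSectorDecomposition hf h0).unique
    (kappaLimit_of_isSectorDecomposition hf hC), alternatingNumberSum_eq_sum_wedgeId hf]
  exact Finset.sum_congr rfl fun m _ => (wedgeId_numberSumCoeff_succ f _).symm

/-! ### The algebras of operators on the sectors -/

theorem sector_ext_wedge {n : ℕ} {S T : Sector H n →L[ℂ] Sector H n}
    (h : ∀ v, S (wedge v) = T (wedge v)) : S = T := by
  have h1 : S ∘L antisymmProj n = T ∘L antisymmProj n := clm_ext_tprod h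
  ext1 x
  obtain ⟨y, rfl⟩ := antisymmProj_surjective n x
  exact congrArg (fun R => R y) h1

theorem wedge_comp_perm {n : ℕ} (v : Fin n → H) (σ : Equiv.Perm (Fin n)) :
    wedge (v ∘ σ) = ((Equiv.Perm.sign σ : ℤ) : ℂ) • wedge v := by
  refine ext_inner_right ℂ fun x => ?_
  rw [inner_smul_left, wedge, wedge, inner_antisymmProj_left, inner_antisymmProj_left,
    sectorIncl_mem n x σ v, map_intCast]

theorem opTprod_tprod (n : ℕ) (A : Fin n → (H →L[ℂ] H)) (v : Fin n → H) :
    opTprod n A (tprod n v) = tprod n fun i => A i (v i) := by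
  induction n with
  | zero => rfl
  | succ n ih =>
    rw [opTprod, tprod_succ, opTensor_tensorLeft, ih, tprod_succ]; rfl

theorem opTprod_id (n : ℕ) :
    opTprod n (fun _ => ContinuousLinearMap.id ℂ H) = ContinuousLinearMap.id ℂ (TPow H n) :=
  clm_ext_tprod fun v => by rw [opTprod_tprod]; rfl

theorem compress_opTprod_wedge {n : ℕ} (A : Fin n → (H →L[ℂ] H)) (v : Fin n → H) :
    compress (opTprod n A) (wedge v) = ((n.factorial : ℂ)⁻¹) • ∑ τ : Equiv.Perm (Fin n),
      ((Equiv.Perm.sign τ : ℤ) : ℂ) • wedge fun i => A i (v (τ i)) := by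
  rw [compress, ContinuousLinearMap.comp_apply, ContinuousLinearMap.comp_apply, sectorIncl_wedge]
  simp only [map_smul, map_sum, opTprod_tprod]
  rfl

/-- Substituting τσ for τ in the antisymmetrization pulls σ out of the wedge with a sign that
cancels the one from sgn(τσ). -/
theorem compress_opTprod_comp_perm {n : ℕ} (A : Fin n → (H →L[ℂ] H)) (σ : Equiv.Perm (Fin n)) :
    compress (opTprod n (A ∘ σ)) = compress (opTprod n A) := by
  refine sector_ext_wedge fun v => ?_
  rw [compress_opTprod_wedge, compress_opTprod_wedge, ← Equiv.sum_comp (Equiv.mulRight σ)]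
  congr 1
  refine Finset.sum_congr rfl fun τ _ => ?_
  have h : (fun i => (A ∘ σ) i (v ((Equiv.mulRight σ τ) i))) =
      (fun i => A i (v (τ i))) ∘ σ := rfl
  rw [h, wedge_comp_perm, smul_smul]
  congr 1
  rw [Equiv.coe_mulRight, map_mul, Units.val_mul, Int.cast_mul, mul_assoc, ← Int.cast_mul,
    ← Units.val_mul, Int.units_mul_self]
  simp

/-- All n! terms of the average have the same compression, so a single ordering suffices. -/
theorem wedgeOp_eq_compress {n : ℕ} (A : Fin n → (H →L[ℂ] H)) :
    wedgeOp A = compress (opTprod n A) := by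
  have h : wedgeOp A = ((n.factorial : ℂ)⁻¹) • ∑ σ : Equiv.Perm (Fin n),
      compress (opTprod n (A ∘ σ)) := by
    ext1 x
    simp only [wedgeOp, compress, ContinuousLinearMap.comp_apply, smul_apply, sum_apply, map_smul,
      map_sum]
  rw [h]
  simp only [compress_opTprod_comp_perm, Finset.sum_const, Finset.card_univ, Fintype.card_perm,
    Fintype.card_fin]
  rw [← Nat.cast_smul_eq_nsmul ℂ, smul_smul,
    inv_mul_cancel₀ (by exact_mod_cast n.factorial_ne_zero), one_smul]

/-- The rank one operator `v ↦ ⟨f, v⟩ f`. -/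
def rankOneSelf (f : H) : H →L[ℂ] H := (innerSL ℂ f).smulRight f

theorem isCompactOperator_rankOneSelf (f : H) : IsCompactOperator (rankOneSelf f) := by
  have h : IsCompactOperator (innerSL ℂ f : H →L[ℂ] ℂ) :=
    isCompactOperator_of_locallyCompactSpace_dom _
  exact h.clm_comp (ContinuousLinearMap.toSpanSingleton ℂ f)

theorem opTensor_rankOneSelf (f : H) (n : ℕ) :
    opTensor (rankOneSelf f) (ContinuousLinearMap.id ℂ (TPow H n)) =
      tensorLeft n f ∘L contract n f :=
  tpow_ext fun g ψ => by
    rw [opTensor_tensorLeft, ContinuousLinearMap.comp_apply, contract_tensorLeft, rankOneSelf,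
      ContinuousLinearMap.smulRight_apply, innerSL_apply_apply, map_smul]
    simp [tensorLeft]

/-- |f⟩⟨f| ⊗ 1 is contraction with f followed by tensoring with f; the factor n+1 comes from the
√(n+1) carried by each of a(f) and a*(f). -/
theorem restrictSector_succ_numberOp_eq_wedgeOp (f : H) (n : ℕ) :
    restrictSector (n + 1) (numberOp f) = ((n : ℂ) + 1) •
      wedgeOp (Fin.cons (rankOneSelf f) fun _ => ContinuousLinearMap.id ℂ H :
        Fin (n + 1) → (H →L[ℂ] H)) := by
  rw [wedgeOp_eq_compress, opTprod, Fin.tail_cons, Fin.cons_zero, opTprod_id,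
    opTensor_rankOneSelf, restrictSector_succ_numberOp]
  ext1 y
  refine ext_inner_left ℂ fun x => ?_
  rw [smul_apply, inner_smul_right, inner_compress, ContinuousLinearMap.comp_apply,
    ContinuousLinearMap.comp_apply, sectorCreation, ContinuousLinearMap.adjoint_inner_right,
    ← inner_sectorIncl, sectorIncl_sectorAnnihilation, sectorIncl_sectorAnnihilation,
    inner_smul_left, inner_smul_right, Complex.conj_ofReal, ← mul_assoc, sqrt_succ_mul_self,
    ← inner_conj_symm (sectorIncl (n + 1) x), ← inner_contract, inner_conj_symm]

theorem restrictSector_numberOp_mem (f : H) (n : ℕ) :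
    restrictSector n (numberOp f) ∈ sectorAlgebra H n := by
  cases n with
  | zero => rw [restrictSector_zero_numberOp]; exact zero_mem _
  | succ n =>
    rw [restrictSector_succ_numberOp_eq_wedgeOp]
    refine Subalgebra.smul_mem (sectorAlgebra H (n + 1)).toSubalgebra ?_ _
    refine StarSubalgebra.le_topologicalClosure _ (StarAlgebra.subset_adjoin ℂ _
      ⟨1, _, Nat.succ_le_succ n.zero_le, fun i => ?_, fun i => ?_, rfl⟩)
    · refine Fin.cases (fun _ => isCompactOperator_rankOneSelf f) (fun i hi => ?_) i
      simp at hi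
    · refine Fin.cases (fun h => ?_) (fun i _ => rfl) i
      simp at h

theorem restrictSector_numberProd_mem (f : ℕ → H) (n k : ℕ) :
    restrictSector n (numberProd f k) ∈ sectorAlgebra H n := by
  induction k with
  | zero => rw [numberProd_zero, restrictSector_one]; exact one_mem _
  | succ k ih =>
    rw [numberProd_succ, restrictSector_mul _ (numberOp_preservesSectors _)]
    exact mul_mem ih (restrictSector_numberOp_mem _ n)

theorem alternatingNumberSum_mem_coherentSequences {f : ℕ → H} (hf : Orthonormal ℂ f) :
    alternatingNumberSum f ∈ coherentSequences H := by
  refine ⟨fun n => sum_mem fun k _ => ?_, kappaEq_alternatingNumberSum hf, 1, ?_⟩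
  · exact Subalgebra.smul_mem (sectorAlgebra H n).toSubalgebra
      (restrictSector_numberProd_mem f n k) _
  · rintro _ ⟨n, rfl⟩
    exact norm_alternatingNumberSum_le hf n

/-! ### The main result -/

theorem exists_mem_carZeroHat {f : ℕ → H} (hf : Orthonormal ℂ f) :
    ∃ A : Fock H →L[ℂ] Fock H,
      (∀ (ψ : Fock H) (n : ℕ), sectorEval n (A ψ) = alternatingNumberSum f n (sectorEval n ψ)) ∧
      A ∈ carZeroHat H ∧ A ∉ carZero H ∧ ∃ ε : ℝ, 0 < ε ∧ ∀ B ∈ carZero H, ε ≤ ‖A - B‖ := by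
  obtain ⟨A, hA⟩ := exists_diagonal (alternatingNumberSum f) zero_le_one
    (norm_alternatingNumberSum_le hf)
  refine ⟨A, hA, mem_carZeroHat_of_diagonal hf hA, fun h => ?_, 1 / 2, by norm_num,
    fun B hB => half_le_norm_sub hf hA hB.1⟩
  have := half_le_norm_sub hf hA h.1
  rw [sub_self, norm_zero] at this
  norm_num at this

open MeasureTheory in
/-- `L²(ℝᵈ)` is infinite dimensional. -/
theorem exists_orthonormal_oneParticle {d : ℕ} (hd : 0 < d) :
    ∃ f : ℕ → OneParticle d, Orthonormal ℂ f := by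
  let i0 : Fin d := ⟨0, hd⟩
  -- Distinct centres are at distance at least 2, so the open unit balls are disjoint and their
  -- indicator functions orthogonal.
  let c : ℕ → EuclideanSpace ℝ (Fin d) := fun k => EuclideanSpace.single i0 (2 * k : ℝ)
  let S : ℕ → Set (EuclideanSpace ℝ (Fin d)) := fun k => Metric.ball (c k) 1
  have hfin : ∀ k, volume (S k) ≠ ⊤ := fun k => measure_ball_lt_top.ne
  have hpos : ∀ k, volume (S k) ≠ 0 := fun k => (Metric.measure_ball_pos _ _ one_pos).ne'
  have hdisj : ∀ j k, j ≠ k → Disjoint (S j) (S k) := fun j k h => by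
    refine Metric.ball_disjoint_ball ?_
    have h1 : dist (c j) (c k) = |(2 * j : ℝ) - 2 * k| := by
      rw [PiLp.dist_single_same, Real.dist_eq]
    have h2 : (1 : ℝ) ≤ |(j : ℝ) - k| := by
      have : (1 : ℤ) ≤ |(j : ℤ) - k| := Int.one_le_abs (by omega)
      exact_mod_cast this
    rw [h1, ← mul_sub, abs_mul, abs_two]
    linarith
  let g : ℕ → OneParticle d := fun k =>
    indicatorConstLp 2 (μ := volume) measurableSet_ball (hfin k) (1 : ℂ)
  have hinner : ∀ j k, inner ℂ (g j) (g k) = ((volume.real (S j ∩ S k) : ℝ) : ℂ) := fun j k =>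
    L2.inner_indicatorConstLp_one_indicatorConstLp_one _ _ (hfin j) (hfin k)
  have horth : ∀ j k, j ≠ k → inner ℂ (g j) (g k) = (0 : ℂ) := fun j k h => by
    rw [hinner, (hdisj j k h).inter_eq, measureReal_empty, Complex.ofReal_zero]
  have hne : ∀ k, g k ≠ 0 := fun k h => by
    have h1 := hinner k k
    rw [h, inner_zero_left, Set.inter_self] at h1
    have h2 : volume.real (S k) = 0 := by exact_mod_cast h1.symm
    exact (measureReal_eq_zero_iff (hfin k)).not.mpr (hpos k) h2
  refine ⟨fun k => ((‖g k‖ : ℂ))⁻¹ • g k, fun k => ?_, fun j k h => ?_⟩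
  · rw [norm_smul, norm_inv, Complex.norm_real, norm_norm, inv_mul_cancel₀]
    exact norm_ne_zero_iff.mpr (hne k)
  · simp only [inner_smul_left, inner_smul_right, horth j k h, mul_zero]

end FermiFock

end

theorem mainTheorem8 (d : ℕ) (hd : 0 < d) :
    carZero (OneParticle d) ⊂ carZeroHat (OneParticle d) ∧
    ∀ f : HilbertBasis ℕ ℂ (OneParticle d),
      alternatingNumberSum f ∈ coherentSequences (OneParticle d) ∧
      (∀ (n : ℕ) (i : Fin n → ℕ),
        alternatingNumberSum f n (wedge (f ∘ i)) = 0 ∨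
        alternatingNumberSum f n (wedge (f ∘ i)) = -wedge (f ∘ i)) ∧
      (∀ n : ℕ, ‖alternatingNumberSum f n‖ ≤ 1) ∧
      ∃ A : Fock (OneParticle d) →L[ℂ] Fock (OneParticle d),
        (∀ (ψ : Fock (OneParticle d)) (n : ℕ),
          sectorEval n (A ψ) = alternatingNumberSum f n (sectorEval n ψ)) ∧
        A ∈ carZeroHat (OneParticle d) ∧
        A ∉ carZero (OneParticle d) ∧
        ∃ ε : ℝ, 0 < ε ∧ ∀ B ∈ carZero (OneParticle d), ε ≤ ‖A - B‖ := by
  refine ⟨?_, fun f => ⟨alternatingNumberSum_mem_coherentSequences f.orthonormal,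
    fun n i => alternatingNumberSum_wedge f.orthonormal i,
    norm_alternatingNumberSum_le f.orthonormal, exists_mem_carZeroHat f.orthonormal⟩⟩
  -- For strictness of the inclusion one orthonormal sequence is enough; it need not be a basis.
  obtain ⟨f, hf⟩ := exists_orthonormal_oneParticle hd
  obtain ⟨A, -, hA, hA', -⟩ := exists_mem_carZeroHat hf
  exact Set.ssubset_iff_exists.mpr ⟨carZero_subset_carZeroHat, A, hA, hA'⟩
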